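/- **Conventions.** Let $G$ be a group with a finite generating set $X$, and let $X^\pm=X\cup X^{-1}$. Let $H\le G$ be a finitely generated subgroup. For a finite set $S\subseteq G$ and $g\in\langle S\rangle$, $|g|_S$ denotes the length of a shortest word over $S^\pm$ representing $g$. The distance in the Cayley graph $\Gamma(G,X)$ is $d(g,h)=|g^{-1}h|_X$. For a word $w$ over $X^\pm$ and $t\in\mathbb N$, $w(t)\in G$ is the element represented by the prefix of $w$ of length $t$ (by $w$ itself if $t>|w|$). For $h\in G$, the paths ${}_1v$ and ${}_hw$ *asynchronously $K$-fellow travel* if there are nondecreasing surjections $\phi_1,\phi_2:\mathbb N\to\mathbb N$ with $d(v(\phi_1(t)),h\,w(\phi_2(t)))\le K$ for all $t\in\mathbb N$. The pair $(G,H)$ is *strongly asynchronously coset automatic with coset language* $L\subseteq (X^\pm)^*$ (over $X$) if * $L$ contains at least one representative of each right coset $Hg$ of $H$ in $G$; * $L$ is a regular language; * there is a constant $K$ such that, whenever $v,w\in L$ and $h\in H$ satisfy $d(v,hw)\le 1$, the paths ${}_1v$ and ${}_hw$ asynchronously $K$-fellow travel. For finite $Y,Z\subseteq G$ with $\langle Y\rangle=H$,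 such an $L$ has *limited crossover with respect to $(Y,Z)$* if there is an integer $\lambda\ge1$ such that, for all $g\in\langle Z\rangle$ with $|g|_Z\le\lambda$ and all $u,v\in L$ with $ug\in Hv$, we have $|ugv^{-1}|_Y\le\lambda$. An isomorphism $\phi:H_1=\langle Y_1\rangle\to H_2=\langle Y_2\rangle$ is *stable* with respect to $(Y_1,Y_2)$ if there is an integer $\mu\ge1$ such that $|\phi(h)|_{Y_2}\le\mu$ for all $h\in H_1$ with $|h|_{Y_1}\le\mu$. **Graphs of groups.** Let $\Lambda=(V,\vec E)$ be a finite connected directed graph in which each edge $e$ from $\iota(e)$ to $\tau(e)$ has an opposite edge $\bar e$ from $\tau(e)$ to $\iota(e)$, with $\bar{\bar e}=e$. A graph of groups $\mathcal G$ over $\Lambda$ consists of groups $G_v$ ($v\in V$), subgroups $G_e\le G_{\tau(e)}$ and isomorphisms $\phi_e:G_e\to G_{\bar e}$ with $\phi_{\bar e}=\phi_e^{-1}$ ($e\in\vec E$). For a maximal tree $\mathcal T$ of $\Lambda$, with set of directed edges $\vec E_{\mathcal T}$, the group $\pi_1(\mathcal G)=\pi_1(\mathcal G,\mathcal T)$ is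 generated by the disjoint union of the groups $G_v$ and symbols $s_e$ ($e\in\vec E$), subject to the relations of the $G_v$ together with $s_{\bar e}=s_e^{-1}$ for all $e$, $s_e=1$ for $e\in\vec E_{\mathcal T}$, and $s_e g s_e^{-1}=\phi_e(g)$ for all $e$ and $g\in G_e$. Let $X_v$ and $Y_e$ be finite generating sets of $G_v$ and $G_e$ respectively, with the sets $X_v$ regarded as disjoint alphabets, and let $\mathcal L=\{L^e_{\tau(e)}\}_{e\in\vec E}$ be a collection of languages $L^e_{\tau(e)}\subseteq(X_{\tau(e)}^\pm)^*$. The *Higgins coset language* $L(\mathcal G,\mathcal L,e_0,\mathcal T)$ is the set of all words over $X^\pm$, where $X=\bigcup_v X_v\cup\{s_e: e\in\vec E\setminus\vec E_{\mathcal T}\}$, obtained by omitting all letters $s_e$ with $e\in\vec E_{\mathcal T}$ from the words $$u_0s_{e_1}u_1\cdots s_{e_k}u_k\qquad(k\ge0)$$ such that $e_1\cdots e_k$ is a directed path in $\Lambda$ starting at $\tau(e_0)$; $u_0\in L^{e_0}_{\tau(e_0)}$ and $u_i\in L^{e_i}_{\tau(e_i)}$ for $1\le i\le k$; if $e_{i+1}=\bar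 e_i$ then $u_i$ does not represent an element of $G_{e_i}$; and if $k>0$ and $e_k\in\vec E_{\mathcal T}$ then $u_k$ does not represent an element of $G_{e_k}$. **Theorem.** With this notation, suppose that for each $e\in\vec E$: 1. the pair $(G_{\tau(e)},G_e)$ is strongly asynchronously coset automatic with coset language $L^e_{\tau(e)}\subseteq(X^\pm_{\tau(e)})^*$ containing the empty word; 2. $\phi_e:G_e\to G_{\bar e}$ is stable with respect to $(Y_e,Y_{\bar e})$; 3. for each $f\in\vec E$ with $\tau(f)=\tau(e)$, the language $L^e_{\tau(e)}$ has limited crossover with respect to $(Y_e,Y_f)$. Then, for every maximal tree $\mathcal T$ of $\Lambda$ and every $e_0\in\vec E$, the set $X$ generates $\pi_1(\mathcal G,\mathcal T)$, and the pair $(\pi_1(\mathcal G,\mathcal T),G_{e_0})$, where $G_{e_0}$ stands for its image in $\pi_1(\mathcal G,\mathcal T)$, is strongly asynchronously coset automatic over $X$ with coset language $L(\mathcal G,\mathcal L,e_0,\mathcal T)$. -/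

import Mathlib

universe u v w

/-! ### Words, Cayley graphs and coset languages -/

section Words

variable {G : Type*} [Group G]

/-- `|g|_S ≤ n`: the element `g` is a product of at most `n` elements of `S ∪ S⁻¹`
(in particular `g` lies in the subgroup generated by `S`). -/
def WordLengthLE (S : Set G) (n : ℕ) (g : G) : Prop :=
  ∃ l : List G, l.length ≤ n ∧ (∀ s ∈ l, s ∈ S ∨ s⁻¹ ∈ S) ∧ l.prod = g

variable {ι : Type*}

/-- The element represented by a word over `X^±`. Here the generating set `X` is given by a
family `x : ι → G`, and the letter `(i, true)` stands for `x i`, the letter `(i, false)` for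
`(x i)⁻¹`. -/
def evalWord (x : ι → G) (l : List (ι × Bool)) : G :=
  (l.map fun p => if p.2 then x p.1 else (x p.1)⁻¹).prod

/-- The distance of `g` and `h` in the Cayley graph of `G` with respect to `x` (with edges
joining `g` to `g * x i`) is at most `n`. -/
def CayleyDistLE (x : ι → G) (n : ℕ) (g h : G) : Prop :=
  WordLengthLE (Set.range x) n (g⁻¹ * h)

/-- The paths labelled `p` from `1` and `q` from `h` in the Cayley graph asynchronously
`K`-fellow travel. The vertex reached after `t` steps of `p` is `evalWord x (p.take t)`, which
is constant for `t ≥ p.length`. -/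
def AsyncFellowTravel (x : ι → G) (K : ℕ) (h : G) (p q : List (ι × Bool)) : Prop :=
  ∃ φ₁ φ₂ : ℕ → ℕ, Monotone φ₁ ∧ Function.Surjective φ₁ ∧ Monotone φ₂ ∧ Function.Surjective φ₂ ∧
    ∀ t, CayleyDistLE x K (evalWord x (p.take (φ₁ t))) (h * evalWord x (q.take (φ₂ t)))

/-- `L` contains at least one representative of each right coset `H g` of `H` in `G`. -/
def IsCosetLanguage (x : ι → G) (H : Subgroup G) (L : Language (ι × Bool)) : Prop :=
  ∀ g : G, ∃ p ∈ L, ∃ h ∈ H, evalWord x p = h * g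

/-- The pair `(G, H)` is strongly asynchronously coset automatic with coset language `L` over
the finite generating family `x` of `G`. -/
structure IsStronglyAsyncCosetAutomatic (x : ι → G) (H : Subgroup G)
    (L : Language (ι × Bool)) : Prop where
  finite_generators : Finite ι
  generates : Subgroup.closure (Set.range x) = ⊤
  subgroup_fg : H.FG
  isCosetLanguage : IsCosetLanguage x H L
  isRegular : L.IsRegular
  fellowTravel : ∃ K : ℕ, ∀ p ∈ L, ∀ q ∈ L, ∀ h ∈ H,
    CayleyDistLE x 1 (evalWord x p) (h * evalWord x q) → AsyncFellowTravel x K h p q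

/-- `k`-limited crossover of the coset language `L` for `(G, ⟨Y⟩)` with respect to `(Y, Z)`. -/
def HasLimitedCrossoverWith (k : ℕ) (x : ι → G) (L : Language (ι × Bool)) (Y Z : Set G) : Prop :=
  ∀ g : G, WordLengthLE Z k g → ∀ p ∈ L, ∀ q ∈ L,
    evalWord x p * g * (evalWord x q)⁻¹ ∈ Subgroup.closure Y →
      WordLengthLE Y k (evalWord x p * g * (evalWord x q)⁻¹)

/-- Limited crossover: `k`-limited crossover for some `k ≥ 1`. -/
def HasLimitedCrossover (x : ι → G) (L : Language (ι × Bool)) (Y Z : Set G) : Prop :=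
  ∃ k : ℕ, 1 ≤ k ∧ HasLimitedCrossoverWith k x L Y Z

/-- Stability of an isomorphism `φ : H₁ ≃* H₂` with respect to generating sets `Y₁`, `Y₂` of the
subgroups `H₁`, `H₂`: for some `μ ≥ 1`, elements of `Y₁`-length at most `μ` are mapped to elements
of `Y₂`-length at most `μ`. -/
def IsStableIso {G₁ G₂ : Type*} [Group G₁] [Group G₂] {H₁ : Subgroup G₁} {H₂ : Subgroup G₂}
    (φ : H₁ ≃* H₂) (Y₁ : Set G₁) (Y₂ : Set G₂) : Prop :=
  ∃ μ : ℕ, 1 ≤ μ ∧ ∀ h : H₁, WordLengthLE Y₁ μ (h : G₁) → WordLengthLE Y₂ μ (φ h : G₂)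

end Words

/-! ### Maximal trees -/

/-- A set `T` of directed edges is (the edge set of) a maximal tree: it is closed under reversal,
contains no loops and no two parallel edges, and the simple graph on all the vertices that it
spans is a tree. -/
structure IsMaximalTree {V : Type u} [Quiver.{v} V] [Quiver.HasInvolutiveReverse V]
    (T : WideSubquiver V) : Prop where
  reverse_mem : ∀ {a b : V} (e : a ⟶ b), e ∈ T a b → Quiver.reverse e ∈ T b a
  no_loop : ∀ a : V, T a a = ∅
  no_parallel : ∀ a b : V, (T a b).Subsingleton
  isTree : (SimpleGraph.fromRel fun a b : V => (T a b).Nonempty).IsTree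

/-! ### Graphs of groups -/

/-- A graph of groups over the graph with vertex set `V`, directed edges `e : a ⟶ b`
(with `ι(e) = a`, `τ(e) = b`) and opposite edges `Quiver.reverse e : b ⟶ a`. -/
structure GraphOfGroups (V : Type u) [Quiver.{v} V] [Quiver.HasInvolutiveReverse V] where
  vertexGroup : V → Type w
  [group : ∀ a, Group (vertexGroup a)]
  edgeGroup : ∀ {a b : V}, (a ⟶ b) → Subgroup (vertexGroup b)
  φ : ∀ {a b : V} (e : a ⟶ b), edgeGroup e ≃* edgeGroup (Quiver.reverse e)
  φ_reverse : ∀ {a b : V} (e : a ⟶ b) (g : edgeGroup e),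
    (φ (Quiver.reverse e) (φ e g) : vertexGroup b) = (g : vertexGroup b)

attribute [instance] GraphOfGroups.group

namespace GraphOfGroups

variable {V : Type u} [Quiver.{v} V] [Quiver.HasInvolutiveReverse V]

/-- The free product of all the vertex groups and the free group on the symbols `s_e`. -/
abbrev FreeProd (𝒢 : GraphOfGroups.{u, v, w} V) : Type _ :=
  Monoid.Coprod (Monoid.CoprodI 𝒢.vertexGroup) (FreeGroup (Quiver.Total V))

/-- A vertex group element in the free product. -/
def preVertex (𝒢 : GraphOfGroups.{u, v, w} V) (a : V) : 𝒢.vertexGroup a →* 𝒢.FreeProd :=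
  Monoid.Coprod.inl.comp Monoid.CoprodI.of

/-- The symbol `s_e` in the free product. -/
def preStable (𝒢 : GraphOfGroups.{u, v, w} V) {a b : V} (e : a ⟶ b) : 𝒢.FreeProd :=
  Monoid.Coprod.inr (FreeGroup.of ⟨a, b, e⟩)

/-- The defining relators of the fundamental group at `T`. -/
inductive Relator (𝒢 : GraphOfGroups.{u, v, w} V) (T : WideSubquiver V) : 𝒢.FreeProd → Prop
  /-- `s_ē = s_e⁻¹` -/
  | inv {a b : V} (e : a ⟶ b) :
      Relator 𝒢 T (𝒢.preStable (Quiver.reverse e) * 𝒢.preStable e)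
  /-- `s_e = 1` for `e` in the tree -/
  | tree {a b : V} (e : a ⟶ b) (he : e ∈ T a b) : Relator 𝒢 T (𝒢.preStable e)
  /-- `s_e g s_e⁻¹ = φ_e(g)` for `g` in the edge group -/
  | conj {a b : V} (e : a ⟶ b) (g : 𝒢.edgeGroup e) :
      Relator 𝒢 T (𝒢.preStable e * 𝒢.preVertex b g * (𝒢.preStable e)⁻¹ *
        (𝒢.preVertex a (𝒢.φ e g))⁻¹)

/-- The fundamental group `π₁(𝒢, T)`. -/
def FundamentalGroup (𝒢 : GraphOfGroups.{u, v, w} V) (T : WideSubquiver V) : Type _ :=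
  𝒢.FreeProd ⧸ Subgroup.normalClosure {r | Relator 𝒢 T r}

instance (𝒢 : GraphOfGroups.{u, v, w} V) (T : WideSubquiver V) : Group (𝒢.FundamentalGroup T) :=
  inferInstanceAs (Group (𝒢.FreeProd ⧸ Subgroup.normalClosure {r | Relator 𝒢 T r}))

/-- The canonical map from a vertex group to the fundamental group. -/
def ofVertex (𝒢 : GraphOfGroups.{u, v, w} V) (T : WideSubquiver V) (a : V) :
    𝒢.vertexGroup a →* 𝒢.FundamentalGroup T :=
  (QuotientGroup.mk' (Subgroup.normalClosure {r | Relator 𝒢 T r})).comp (𝒢.preVertex a)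

/-- The element `s_e` of the fundamental group. -/
def stable (𝒢 : GraphOfGroups.{u, v, w} V) (T : WideSubquiver V) {a b : V} (e : a ⟶ b) :
    𝒢.FundamentalGroup T :=
  QuotientGroup.mk' (Subgroup.normalClosure {r | Relator 𝒢 T r}) (𝒢.preStable e)

/-- The image of the edge group `G_e` in the fundamental group. -/
def edgeSubgroup (𝒢 : GraphOfGroups.{u, v, w} V) (T : WideSubquiver V) {a b : V} (e : a ⟶ b) :
    Subgroup (𝒢.FundamentalGroup T) :=
  (𝒢.edgeGroup e).map (𝒢.ofVertex T b)

/-! ### The Higgins coset language -/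

/-- The generating family of a vertex group given by a finite set. -/
def gens (𝒢 : GraphOfGroups.{u, v, w} V) (X : ∀ a, Finset (𝒢.vertexGroup a)) (a : V) :
    X a → 𝒢.vertexGroup a :=
  Subtype.val

/-- The alphabet of generators `X̂ = ⋃ X_v ∪ {s_e : e}`, as a disjoint union of symbols. -/
abbrev FullGen (𝒢 : GraphOfGroups.{u, v, w} V) (X : ∀ a, Finset (𝒢.vertexGroup a)) : Type _ :=
  (Σ a, X a) ⊕ Quiver.Total V

/-- The alphabet of generators `⋃ X_v ∪ {s_e : e not in the tree}`. -/
abbrev Gen (𝒢 : GraphOfGroups.{u, v, w} V) (X : ∀ a, Finset (𝒢.vertexGroup a))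
    (T : WideSubquiver V) : Type _ :=
  (Σ a, X a) ⊕ {e : Quiver.Total V // e.hom ∉ T e.left e.right}

/-- The elements of the fundamental group given by the generators in `Gen`. -/
def genMap (𝒢 : GraphOfGroups.{u, v, w} V) (X : ∀ a, Finset (𝒢.vertexGroup a))
    (T : WideSubquiver V) : 𝒢.Gen X T → 𝒢.FundamentalGroup T :=
  Sum.elim (fun y => 𝒢.ofVertex T y.1 (𝒢.gens X y.1 y.2)) (fun e => 𝒢.stable T e.1.hom)

/-- A word over `X_a^±` seen as a word over `X̂^±`. -/
def liftWord (𝒢 : GraphOfGroups.{u, v, w} V) (X : ∀ a, Finset (𝒢.vertexGroup a)) (a : V)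
    (l : List (X a × Bool)) : List (𝒢.FullGen X × Bool) :=
  l.map fun p => (Sum.inl ⟨a, p.1⟩, p.2)

open Classical in
/-- Deflation of a word over `X̂^±`: all letters `s_e^{±1}` with `e` in the tree are omitted. -/
noncomputable def deflate (𝒢 : GraphOfGroups.{u, v, w} V) (X : ∀ a, Finset (𝒢.vertexGroup a))
    (T : WideSubquiver V) (l : List (𝒢.FullGen X × Bool)) : List (𝒢.Gen X T × Bool) :=
  l.filterMap fun p =>
    match p with
    | (Sum.inl y, ε) => some (Sum.inl y, ε)
    | (Sum.inr e, ε) =>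
      if h : e.hom ∉ T e.left e.right then some (Sum.inr ⟨e, h⟩, ε) else none

/-- A syllable `s_e u`, where `u` is a word over `X_{τ(e)}^±`. -/
structure Syllable (𝒢 : GraphOfGroups.{u, v, w} V) (X : ∀ a, Finset (𝒢.vertexGroup a)) where
  src : V
  tgt : V
  edge : src ⟶ tgt
  word : List (X tgt × Bool)

namespace Syllable

variable {𝒢 : GraphOfGroups.{u, v, w} V} {X : ∀ a, Finset (𝒢.vertexGroup a)}

/-- The word `s_e u` over `X̂^±`. -/
def toWord (s : 𝒢.Syllable X) : List (𝒢.FullGen X × Bool) :=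
  (Sum.inr ⟨s.src, s.tgt, s.edge⟩, true) :: 𝒢.liftWord X s.tgt s.word

/-- The word `u` of the syllable `s_e u` represents an element of `G_e`. -/
def InEdgeGroup (s : 𝒢.Syllable X) : Prop :=
  evalWord (𝒢.gens X s.tgt) s.word ∈ 𝒢.edgeGroup s.edge

/-- The edge of `t` is the opposite of the edge of `s`. -/
def IsReverse (s t : 𝒢.Syllable X) : Prop :=
  (⟨t.src, t.tgt, t.edge⟩ : Quiver.Total V) = ⟨s.tgt, s.src, Quiver.reverse s.edge⟩

end Syllable

/-- The conditions on the syllables `s_{e₁} u₁ ⋯ s_{e_k} u_k` of a word of the inflated Higgins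
(coset) language based at the vertex `a`, for a collection `L` of coset languages. -/
structure IsHigginsSequence (𝒢 : GraphOfGroups.{u, v, w} V) (X : ∀ a, Finset (𝒢.vertexGroup a))
    (T : WideSubquiver V) (L : ∀ {a b : V}, (a ⟶ b) → Language (X b × Bool)) (a : V)
    (l : List (𝒢.Syllable X)) : Prop where
  /-- the edges form a directed path … -/
  isPath : l.IsChain fun s t => s.tgt = t.src
  /-- … that starts at `a` -/
  start : ∀ s ∈ l.head?, s.src = a
  mem_lang : ∀ s ∈ l, s.word ∈ L s.edge
  /-- if `e_{i+1} = ē_i` then `u_i` does not represent an element of `G_{e_i}` -/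
  reduced : l.IsChain fun s t => s.IsReverse t → ¬ s.InEdgeGroup
  /-- if `k > 0` and `e_k` is in the tree, then `u_k` does not represent an element of `G_{e_k}` -/
  last : ∀ s ∈ l.getLast?, s.edge ∈ T s.src s.tgt → ¬ s.InEdgeGroup

/-- The inflated Higgins coset language: all the words `u₀ s_{e₁} u₁ ⋯ s_{e_k} u_k` with `u₀` in
the coset language of `e₀`, subject to the conditions of `IsHigginsSequence`. -/
def inflatedHigginsCosetLanguage (𝒢 : GraphOfGroups.{u, v, w} V)
    (X : ∀ a, Finset (𝒢.vertexGroup a)) (T : WideSubquiver V)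
    (L : ∀ {a b : V}, (a ⟶ b) → Language (X b × Bool)) {a₀ b₀ : V} (e₀ : a₀ ⟶ b₀) :
    Language (𝒢.FullGen X × Bool) :=
  {p | ∃ u₀ ∈ L e₀, ∃ l : List (𝒢.Syllable X), 𝒢.IsHigginsSequence X T L b₀ l ∧
    p = 𝒢.liftWord X b₀ u₀ ++ l.flatMap Syllable.toWord}

/-- The Higgins coset language for `(π₁(𝒢, T), G_{e₀})`: the deflations of the words of the
inflated one. -/
def higginsCosetLanguage (𝒢 : GraphOfGroups.{u, v, w} V)
    (X : ∀ a, Finset (𝒢.vertexGroup a)) (T : WideSubquiver V)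
    (L : ∀ {a b : V}, (a ⟶ b) → Language (X b × Bool)) {a₀ b₀ : V} (e₀ : a₀ ⟶ b₀) :
    Language (𝒢.Gen X T × Bool) :=
  {p | ∃ q ∈ 𝒢.inflatedHigginsCosetLanguage X T L e₀, p = 𝒢.deflate X T q}

end GraphOfGroups

/-! A word of the Higgins coset language spells a path in the graph whose edges carry coset
representatives. Everything rests on the normal form theorem of Bass-Serre theory: between fixed end
vertices, a group element determines the edges of a reduced path, even up to vertex group factors at
both ends (`WordPath.eq_of_value_eq`). The proof is van der Waerden's trick. Each `s_e` acts
bijectively on normal forms (`NormalForm.cross`), and the sets of normal forms at different base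
vertices are identified along the tree, where `s_e` has to act trivially (`exists_representation`).

Coset representatives exist because edge group elements can be moved to the left across `s_e`, so
the set of elements that have a suitable expression is stable under left multiplication by all
generators (`higginsElements_eq_univ`).

Regularity holds because the conditions on a word concern only adjacent syllables and the question
whether a label lies in its edge group. The labels that do so fellow travel with the empty word,
hence stay in a finite ball, and a finite automaton recognises them (`isRegular_inter_subgroup`,
`isRegular_concatWord`).

For fellow travelling, take two words that agree up to `h` on the left and a generator on the right.
Tree edges with empty labels are invisible after deflation, so both paths may be extended to
suitable end vertices. If the generator lies in a vertex group, a common end vertex is chosen and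
the two paths have the same edges; their labels satisfy `u_i g_i = h_i v_i` with `h_i` in the group
of `e_i` and `g_i = φ(h_{i+1})` for the edge `e_{i+1}`. The `h_i` are bounded from the right end to
the left: the last one by fellow travelling in a vertex group, then stability bounds `g_i` by way of
`h_{i+1}`, and limited crossover bounds `h_i` by way of `g_i`. Both conditions pass to multiples of
their constants, so a single `N` serves for all edges and the bound does not grow along the path
(`exists_uniformConstants`, `UniformConstants.interleaved_path`). A generator `s_f` is absorbed by
appending an edge to one of the two paths (`interleaved_of_comp_edge`). -/

/-! ### Word length -/

section WordLength

variable {G G' : Type*} [Group G] [Group G'] {S : Set G} {m n : ℕ} {g h k : G}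

namespace WordLengthLE

theorem one (S : Set G) (n : ℕ) : WordLengthLE S n 1 := ⟨[], by simp⟩

theorem mono (hg : WordLengthLE S m g) (hmn : m ≤ n) : WordLengthLE S n g := by
  obtain ⟨l, hl, h⟩ := hg
  exact ⟨l, hl.trans hmn, h⟩

theorem mul (hg : WordLengthLE S m g) (hh : WordLengthLE S n h) :
    WordLengthLE S (m + n) (g * h) := by
  obtain ⟨l, hl, h1, rfl⟩ := hg
  obtain ⟨l', hl', h2, rfl⟩ := hh
  refine ⟨l ++ l', by simp; omega, fun s hs => ?_, by simp⟩
  rcases List.mem_append.1 hs with hs | hs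
  exacts [h1 s hs, h2 s hs]

theorem inv (hg : WordLengthLE S n g) : WordLengthLE S n g⁻¹ := by
  obtain ⟨l, hl, h1, rfl⟩ := hg
  refine ⟨(l.map (·⁻¹)).reverse, by simpa, fun s hs => ?_, by rw [List.prod_inv_reverse]⟩
  simp only [List.mem_reverse, List.mem_map] at hs
  obtain ⟨t, ht, rfl⟩ := hs
  simpa [or_comm] using h1 t ht

theorem map {S' : Set G'} (f : G →* G') (hf : ∀ s ∈ S, f s ∈ S') (hg : WordLengthLE S n g) :
    WordLengthLE S' n (f g) := by
  obtain ⟨l, hl, h1, rfl⟩ := hg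
  refine ⟨l.map f, by simpa, fun s hs => ?_, by rw [map_list_prod]⟩
  obtain ⟨t, ht, rfl⟩ := List.mem_map.1 hs
  refine (h1 t ht).imp (hf t) fun h => ?_
  rw [← map_inv]
  exact hf _ h

theorem of_mem (hg : g ∈ S) : WordLengthLE S 1 g :=
  ⟨[g], by simp, by simp [hg], by simp⟩

theorem zero_iff : WordLengthLE S 0 g ↔ g = 1 := by
  refine ⟨?_, ?_⟩
  · rintro ⟨l, hl, -, rfl⟩
    simp [List.eq_nil_of_length_eq_zero (Nat.le_zero.1 hl)]
  · rintro rfl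
    exact one S 0

theorem one_cases (hg : WordLengthLE S 1 g) : g = 1 ∨ g ∈ S ∨ g⁻¹ ∈ S := by
  obtain ⟨l, hl, h, rfl⟩ := hg
  rcases l with _ | ⟨a, _ | ⟨b, l⟩⟩
  · simp
  · right
    simpa using h a (by simp)
  · simp at hl

theorem split (hg : WordLengthLE S (m + n) g) :
    ∃ g₁ g₂, WordLengthLE S m g₁ ∧ WordLengthLE S n g₂ ∧ g = g₁ * g₂ := by
  obtain ⟨l, hl, h, rfl⟩ := hg
  refine ⟨(l.take m).prod, (l.drop m).prod, ⟨l.take m, by simp, fun s hs => h s ?_, rfl⟩,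
    ⟨l.drop m, by simp; omega, fun s hs => h s ?_, rfl⟩, (List.prod_take_mul_prod_drop _ _).symm⟩
  exacts [List.mem_of_mem_take hs, List.mem_of_mem_drop hs]

theorem mem_closure (hg : WordLengthLE S n g) : g ∈ Subgroup.closure S := by
  obtain ⟨l, -, h, rfl⟩ := hg
  refine Subgroup.list_prod_mem _ fun s hs => ?_
  rcases h s hs with h | h
  · exact Subgroup.subset_closure h
  · simpa using inv_mem (Subgroup.subset_closure h)

end WordLengthLE

theorem exists_wordLengthLE (hg : g ∈ Subgroup.closure S) : ∃ n, WordLengthLE S n g := by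
  induction hg using Subgroup.closure_induction with
  | mem x hx => exact ⟨1, .of_mem hx⟩
  | one => exact ⟨0, .one S 0⟩
  | mul x y _ _ hx hy =>
    obtain ⟨m, hm⟩ := hx
    obtain ⟨n, hn⟩ := hy
    exact ⟨m + n, hm.mul hn⟩
  | inv x _ hx =>
    obtain ⟨m, hm⟩ := hx
    exact ⟨m, hm.inv⟩

theorem exists_forall_wordLengthLE {B : Set G} (hB : B.Finite)
    (hS : ∀ g ∈ B, g ∈ Subgroup.closure S) : ∃ n, ∀ g ∈ B, WordLengthLE S n g := by
  choose! f hf using fun g hg => exists_wordLengthLE (hS g hg)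
  obtain ⟨n, hn⟩ := (hB.image f).bddAbove
  exact ⟨n, fun g hg => (hf g hg).mono (hn ⟨g, hg, rfl⟩)⟩

theorem finite_setOf_wordLengthLE (hS : S.Finite) (n : ℕ) : {g | WordLengthLE S n g}.Finite := by
  induction n with
  | zero => simp [WordLengthLE.zero_iff]
  | succ n ih =>
    have h1 : {g | WordLengthLE S 1 g}.Finite := by
      refine ((Set.finite_singleton 1).union (hS.union (hS.image (·⁻¹)))).subset fun g hg => ?_
      rcases hg.one_cases with h | h | h
      · exact Or.inl h
      · exact Or.inr (Or.inl h)
      · exact Or.inr (Or.inr ⟨_, h, inv_inv g⟩)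
    refine (Set.Finite.image2 (fun a b => a * b) ih h1).subset fun g hg => ?_
    obtain ⟨a, b, ha, hb, rfl⟩ := hg.split
    exact ⟨a, ha, b, hb, rfl⟩

variable {ι ι' : Type*} {x : ι → G}

@[simp] theorem evalWord_nil (x : ι → G) : evalWord x [] = 1 := rfl

theorem evalWord_append (x : ι → G) (p q : List (ι × Bool)) :
    evalWord x (p ++ q) = evalWord x p * evalWord x q := by simp [evalWord]

theorem evalWord_cons (x : ι → G) (a : ι × Bool) (p : List (ι × Bool)) :
    evalWord x (a :: p) = evalWord x [a] * evalWord x p := evalWord_append x [a] p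

theorem map_evalWord (f : G →* G') {x' : ι' → G'} {j : ι → ι'} (hj : ∀ i, x' (j i) = f (x i))
    (p : List (ι × Bool)) : evalWord x' (p.map (Prod.map j id)) = f (evalWord x p) := by
  simp only [evalWord, map_list_prod, List.map_map]
  congr 1
  refine List.map_congr_left fun a _ => ?_
  rcases a with ⟨i, _ | _⟩ <;> simp [hj]

theorem wordLengthLE_evalWord_singleton (x : ι → G) (a : ι × Bool) :
    WordLengthLE (Set.range x) 1 (evalWord x [a]) := by
  rcases a with ⟨i, _ | _⟩
  · simpa [evalWord] using (WordLengthLE.of_mem (S := Set.range x) ⟨i, rfl⟩).inv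
  · simpa [evalWord] using WordLengthLE.of_mem (S := Set.range x) ⟨i, rfl⟩

namespace CayleyDistLE

theorem refl (x : ι → G) (n : ℕ) (g : G) : CayleyDistLE x n g g := by
  simpa [CayleyDistLE] using WordLengthLE.one _ n

theorem symm (h₁ : CayleyDistLE x n g h) : CayleyDistLE x n h g := by
  simpa [CayleyDistLE] using h₁.inv

theorem trans (h₁ : CayleyDistLE x m g h) (h₂ : CayleyDistLE x n h k) :
    CayleyDistLE x (m + n) g k := by
  simpa [CayleyDistLE, mul_assoc] using WordLengthLE.mul h₁ h₂

theorem mono (h₁ : CayleyDistLE x m g h) (hmn : m ≤ n) : CayleyDistLE x n g h :=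
  WordLengthLE.mono h₁ hmn

theorem mul_left_iff : CayleyDistLE x n (k * g) (k * h) ↔ CayleyDistLE x n g h := by
  simp [CayleyDistLE, mul_assoc]

theorem map (f : G →* G') {x' : ι' → G'} {j : ι → ι'} (hj : ∀ i, x' (j i) = f (x i))
    (h₁ : CayleyDistLE x n g h) : CayleyDistLE x' n (f g) (f h) := by
  rw [CayleyDistLE, ← map_inv, ← map_mul]
  refine WordLengthLE.map f ?_ h₁
  rintro _ ⟨i, rfl⟩
  exact ⟨j i, hj i⟩

theorem mul_letter (x : ι → G) (g : G) (a : ι × Bool) :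
    CayleyDistLE x 1 g (g * evalWord x [a]) := by
  simpa [CayleyDistLE] using wordLengthLE_evalWord_singleton x a

end CayleyDistLE

theorem Monotone.map_zero_of_surjective {φ : ℕ → ℕ} (h1 : Monotone φ)
    (h2 : Function.Surjective φ) : φ 0 = 0 := by
  obtain ⟨t, ht⟩ := h2 0
  have := h1 t.zero_le
  omega

/-! ### Interleavings of paths -/

/-- The paths labelled `p` from `g` and `q` from `h` can be traversed simultaneously, advancing one
of them by one letter at each step, in such a way that the distance is at most `K` all the time. -/
inductive Interleaved (x : ι → G) (K : ℕ) :
    G → G → List (ι × Bool) → List (ι × Bool) → Prop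
  | nil {g h : G} : CayleyDistLE x K g h → Interleaved x K g h [] []
  | left {g h : G} {a : ι × Bool} {p q : List (ι × Bool)} : CayleyDistLE x K g h →
      Interleaved x K (g * evalWord x [a]) h p q → Interleaved x K g h (a :: p) q
  | right {g h : G} {b : ι × Bool} {p q : List (ι × Bool)} : CayleyDistLE x K g h →
      Interleaved x K g (h * evalWord x [b]) p q → Interleaved x K g h p (b :: q)

namespace Interleaved

variable {K K' : ℕ} {p q r p' q' : List (ι × Bool)}

theorem dist (H : Interleaved x K g h p q) : CayleyDistLE x K g h := by
  cases H <;> assumption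

theorem mono (H : Interleaved x K g h p q) (hK : K ≤ K') : Interleaved x K' g h p q := by
  induction H with
  | nil h => exact .nil (h.mono hK)
  | left h _ ih => exact .left (h.mono hK) ih
  | right h _ ih => exact .right (h.mono hK) ih

theorem symm (H : Interleaved x K g h p q) : Interleaved x K h g q p := by
  induction H with
  | nil h => exact .nil h.symm
  | left h _ ih => exact .right h.symm ih
  | right h _ ih => exact .left h.symm ih

theorem translate_map (f : G →* G') {x' : ι' → G'} {j : ι → ι'} (hj : ∀ i, x' (j i) = f (x i))
    (k : G') (H : Interleaved x K g h p q) :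
    Interleaved x' K (k * f g) (k * f h) (p.map (Prod.map j id)) (q.map (Prod.map j id)) := by
  have key (a : ι × Bool) : evalWord x' [Prod.map j id a] = f (evalWord x [a]) :=
    map_evalWord f hj [a]
  induction H with
  | nil h => exact .nil (CayleyDistLE.mul_left_iff.2 (h.map f hj))
  | left h _ ih =>
    refine .left (CayleyDistLE.mul_left_iff.2 (h.map f hj)) ?_
    rw [key, mul_assoc, ← map_mul]
    exact ih
  | right h _ ih =>
    refine .right (CayleyDistLE.mul_left_iff.2 (h.map f hj)) ?_
    rw [key, mul_assoc, ← map_mul]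
    exact ih

theorem translate (k : G) (H : Interleaved x K g h p q) :
    Interleaved x K (k * g) (k * h) p q := by
  simpa using H.translate_map (x' := x) (MonoidHom.id G) (j := id) (fun _ => rfl) k

theorem append (H : Interleaved x K g h p q)
    (H' : Interleaved x K (g * evalWord x p) (h * evalWord x q) p' q') :
    Interleaved x K g h (p ++ p') (q ++ q') := by
  induction H with
  | nil h => simpa using H'
  | left h _ ih =>
    refine .left h (ih ?_)
    rwa [mul_assoc, ← evalWord_cons]
  | right h _ ih =>
    refine .right h (ih ?_)
    rwa [mul_assoc, ← evalWord_cons]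

theorem refl (x : ι → G) (g : G) (p : List (ι × Bool)) : Interleaved x 1 g g p p := by
  induction p generalizing g with
  | nil => exact .nil (.refl _ _ _)
  | cons a p ih =>
    exact .left (.refl _ _ _) (.right (CayleyDistLE.mul_letter x g a).symm (ih _))

theorem concat_left (x : ι → G) (g : G) (p : List (ι × Bool)) (a : ι × Bool) :
    Interleaved x 1 g g p (p ++ [a]) := by
  simpa using (refl x g p).append (p' := []) (q' := [a])
    (.right (.refl _ _ _) (.nil (CayleyDistLE.mul_letter _ _ _)))

/-- Serves to cross a deflated letter `s_e`, which is absent for a tree edge. The extra 1 pays for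
the moment when only the first path has moved. -/
theorem option (o : Option (ι × Bool)) (h1 : CayleyDistLE x K g h)
    (h2 : CayleyDistLE x K (g * evalWord x o.toList) (h * evalWord x o.toList)) :
    Interleaved x (K + 1) g h o.toList o.toList := by
  cases o with
  | none => exact .nil (h1.mono K.le_succ)
  | some a =>
    refine .left (h1.mono K.le_succ) (.right ?_ (.nil (h2.mono K.le_succ)))
    exact h2.trans (CayleyDistLE.mul_letter _ _ _).symm

/-- The two schedules are synchronised along the middle path: a step of `p` or `r` is performed
alone, and a step of `q` is performed in both schedules at once and leaves no trace in the result.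
-/
theorem trans (H : Interleaved x K g h p q) (H' : Interleaved x K' h k q r) :
    Interleaved x (K + K') g k p r := by
  induction H generalizing k r with
  | @nil g h hd =>
    generalize hq : ([] : List (ι × Bool)) = q at H'
    induction H' with
    | nil hd' => exact .nil (hd.trans hd')
    | left => cases hq
    | right hd' _ ih => exact .right (hd.trans hd') (ih hd hq)
  | left hd _ ih => exact .left (hd.trans H'.dist) (ih H')
  | @right g h b p q hd H ih =>
    generalize hq : b :: q = q' at H'
    induction H' with
    | nil => cases hq
    | left hd' H' =>
      cases hq
      exact ih H'
    | right hd' _ ih' =>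
      subst hq
      exact .right (hd.trans hd') (ih' hd H ih rfl)

theorem exists_reparam (H : Interleaved x K g h p q) :
    ∃ φ₁ φ₂ : ℕ → ℕ, Monotone φ₁ ∧ Function.Surjective φ₁ ∧ Monotone φ₂ ∧ Function.Surjective φ₂ ∧
      ∀ t, CayleyDistLE x K (g * evalWord x (p.take (φ₁ t))) (h * evalWord x (q.take (φ₂ t))) := by
  -- Prefixing one instant to a schedule: `stay` keeps a path at its start during that instant,
  -- `move` lets it read its first letter.
  have stay {φ : ℕ → ℕ} (h1 : Monotone φ) (h2 : Function.Surjective φ) :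
      ∃ ψ : ℕ → ℕ, Monotone ψ ∧ Function.Surjective ψ ∧ ψ 0 = 0 ∧ ∀ t, ψ (t + 1) = φ t := by
    refine ⟨fun t => φ (t - 1), fun a b hab => h1 (by omega), fun n => ?_, h1.map_zero_of_surjective h2,
      fun t => rfl⟩
    obtain ⟨t, ht⟩ := h2 n
    exact ⟨t + 1, ht⟩
  have move {φ : ℕ → ℕ} (h1 : Monotone φ) (h2 : Function.Surjective φ) :
      ∃ ψ : ℕ → ℕ, Monotone ψ ∧ Function.Surjective ψ ∧ ψ 0 = 0 ∧
        ∀ t, ψ (t + 1) = φ t + 1 := by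
    refine ⟨fun t => Nat.casesOn t 0 fun t => φ t + 1, ?_, fun n => ?_, rfl, fun t => rfl⟩
    · refine monotone_nat_of_le_succ fun n => ?_
      rcases n with _ | n
      · exact Nat.zero_le _
      · exact Nat.succ_le_succ (h1 n.le_succ)
    · rcases n with _ | n
      · exact ⟨0, rfl⟩
      · obtain ⟨t, ht⟩ := h2 n
        exact ⟨t + 1, congrArg Nat.succ ht⟩
  induction H with
  | nil h => exact ⟨id, id, monotone_id, Function.surjective_id, monotone_id,
      Function.surjective_id, by simpa using h⟩
  | left h _ ih =>
    obtain ⟨φ₁, φ₂, m1, s1, m2, s2, H⟩ := ih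
    obtain ⟨ψ₁, m1', s1', z1, e1⟩ := move m1 s1
    obtain ⟨ψ₂, m2', s2', z2, e2⟩ := stay m2 s2
    refine ⟨ψ₁, ψ₂, m1', s1', m2', s2', fun t => ?_⟩
    rcases t with _ | t
    · simpa [z1, z2] using h
    · rw [e1, e2, List.take_succ_cons, evalWord_cons, ← mul_assoc]
      exact H t
  | right h _ ih =>
    obtain ⟨φ₁, φ₂, m1, s1, m2, s2, H⟩ := ih
    obtain ⟨ψ₁, m1', s1', z1, e1⟩ := stay m1 s1
    obtain ⟨ψ₂, m2', s2', z2, e2⟩ := move m2 s2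
    refine ⟨ψ₁, ψ₂, m1', s1', m2', s2', fun t => ?_⟩
    rcases t with _ | t
    · simpa [z1, z2] using h
    · rw [e1, e2, List.take_succ_cons, evalWord_cons, ← mul_assoc]
      exact H t

theorem asyncFellowTravel (H : Interleaved x K 1 h p q) : AsyncFellowTravel x K h p q := by
  simpa [AsyncFellowTravel] using H.exists_reparam

end Interleaved

theorem Monotone.succ_eq_or_of_surjective {φ : ℕ → ℕ} (h1 : Monotone φ)
    (h2 : Function.Surjective φ) (t : ℕ) : φ (t + 1) = φ t ∨ φ (t + 1) = φ t + 1 := by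
  by_contra! hne
  have h3 := h1 t.le_succ
  obtain ⟨s, hs⟩ := h2 (φ t + 1)
  rcases le_or_gt s t with hst | hst
  · have := h1 hst
    omega
  · have := h1 (show t + 1 ≤ s from hst)
    have h4 : φ t ≤ φ (t + 1) := h3
    omega

theorem evalWord_take_succ (x : ι → G) (p : List (ι × Bool)) (n : ℕ) :
    (p.drop n = [] ∧ p.take (n + 1) = p.take n) ∨
      ∃ a, p.drop n = a :: p.drop (n + 1) ∧
        evalWord x (p.take (n + 1)) = evalWord x (p.take n) * evalWord x [a] := by
  rcases lt_or_ge n p.length with hn | hn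
  · refine Or.inr ⟨p[n], (List.drop_eq_getElem_cons hn), ?_⟩
    rw [← evalWord_append, List.take_append_getElem]
  · exact Or.inl ⟨List.drop_of_length_le hn, by
      rw [List.take_of_length_le hn, List.take_of_length_le (by omega)]⟩

/-- A monotone surjection of `ℕ` advances by 0 or 1. An instant at which both paths advance is split
into a left and a right step; the position in between is one letter away from the later position,
whence `K + 1`. -/
theorem AsyncFellowTravel.interleaved {K : ℕ} {p q : List (ι × Bool)}
    (H : AsyncFellowTravel x K h p q) : Interleaved x (K + 1) 1 h p q := by
  obtain ⟨φ₁, φ₂, m1, s1, m2, s2, H⟩ := H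
  obtain ⟨t₁, ht₁⟩ := s1 p.length
  obtain ⟨t₂, ht₂⟩ := s2 q.length
  -- Downward induction on time, since both paths are exhausted from `max t₁ t₂` on.
  have key : ∀ n t, max t₁ t₂ - t ≤ n → Interleaved x (K + 1) (evalWord x (p.take (φ₁ t)))
      (h * evalWord x (q.take (φ₂ t))) (p.drop (φ₁ t)) (q.drop (φ₂ t)) := by
    intro n
    induction n with
    | zero =>
      intro t ht
      rw [List.drop_of_length_le, List.drop_of_length_le]
      · exact .nil ((H t).mono K.le_succ)
      · exact ht₂ ▸ m2 (by omega)
      · exact ht₁ ▸ m1 (by omega)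
    | succ n ih =>
      intro t ht
      have H1 := ih (t + 1) (by omega)
      have H0 := H t
      have step1 : ∀ q' k, CayleyDistLE x K (evalWord x (p.take (φ₁ t))) k →
          Interleaved x (K + 1) (evalWord x (p.take (φ₁ (t + 1)))) k (p.drop (φ₁ (t + 1))) q' →
          Interleaved x (K + 1) (evalWord x (p.take (φ₁ t))) k (p.drop (φ₁ t)) q' := by
        intro q' k hk HH
        rcases m1.succ_eq_or_of_surjective s1 t with e | e
        · rwa [e] at HH
        · rw [e] at HH
          rcases evalWord_take_succ x p (φ₁ t) with ⟨e1, e2⟩ | ⟨a, e1, e2⟩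
          · rw [e2, List.drop_eq_nil_iff.2 ((List.drop_eq_nil_iff.1 e1).trans (Nat.le_succ _))] at HH
            rwa [e1]
          · rw [e1]
            rw [e2] at HH
            exact .left (hk.mono K.le_succ) HH
      refine step1 _ _ H0 ?_
      rcases m2.succ_eq_or_of_surjective s2 t with e | e
      · rwa [e] at H1
      · rw [e] at H1
        rcases evalWord_take_succ x q (φ₂ t) with ⟨e1, e2⟩ | ⟨b, e1, e2⟩
        · rw [e2, List.drop_eq_nil_iff.2 ((List.drop_eq_nil_iff.1 e1).trans (Nat.le_succ _))] at H1
          rwa [e1]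
        · rw [e1]
          have hd : CayleyDistLE x (K + 1) (evalWord x (p.take (φ₁ (t + 1))))
              (h * evalWord x (q.take (φ₂ t))) := by
            refine ((H (t + 1)).trans ?_)
            rw [e, e2, ← mul_assoc]
            exact (CayleyDistLE.mul_letter _ _ _).symm
          refine .right hd ?_
          rwa [e2, ← mul_assoc] at H1
  simpa [m1.map_zero_of_surjective s1, m2.map_zero_of_surjective s2] using key _ 0 le_rfl

end WordLength

/-! ### Strongly asynchronously coset automatic pairs -/

namespace IsStronglyAsyncCosetAutomatic

variable {G : Type*} [Group G] {ι : Type*} {x : ι → G} {H : Subgroup G} {L : Language (ι × Bool)}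

theorem exists_interleaved (hL : IsStronglyAsyncCosetAutomatic x H L) :
    ∃ K : ℕ, ∀ p ∈ L, ∀ q ∈ L, ∀ h ∈ H, CayleyDistLE x 1 (evalWord x p) (h * evalWord x q) →
      Interleaved x K 1 h p q := by
  obtain ⟨K, hK⟩ := hL.fellowTravel
  exact ⟨K + 1, fun p hp q hq h hh hd => (hK p hp q hq h hh hd).interleaved⟩

/-- Peel off one letter `a` of the difference and choose a representative `r` of the coset of `p *
a`. Then `p` fellow travels with a translate of `r`, and by induction `r` with a translate of `q`;
the constants add up. -/
theorem exists_interleaved_of_dist (hL : IsStronglyAsyncCosetAutomatic x H L) (n : ℕ) :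
    ∃ K : ℕ, ∀ p ∈ L, ∀ q ∈ L, ∀ h ∈ H, CayleyDistLE x n (evalWord x p) (h * evalWord x q) →
      Interleaved x K 1 h p q := by
  obtain ⟨K, hK⟩ := hL.exists_interleaved
  induction n with
  | zero => exact ⟨K, fun p hp q hq h hh hd => hK p hp q hq h hh (hd.mono zero_le_one)⟩
  | succ n ih =>
    obtain ⟨K', hK'⟩ := ih
    refine ⟨K + K', fun p hp q hq h hh hd => ?_⟩
    rw [CayleyDistLE, add_comm] at hd
    obtain ⟨a, b, ha, hb, hab⟩ := hd.split
    obtain ⟨r, hr, k, hk, hrk⟩ := hL.isCosetLanguage (evalWord x p * a)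
    have e : evalWord x p * a = k⁻¹ * evalWord x r := by rw [hrk]; group
    have H1 : Interleaved x K 1 k⁻¹ p r := by
      refine hK p hp r hr _ (inv_mem hk) ?_
      rw [← e]
      simpa [CayleyDistLE] using ha
    have H2 : Interleaved x K' 1 (k * h) r q := by
      refine hK' r hr q hq _ (mul_mem hk hh) ?_
      rw [hrk, CayleyDistLE]
      convert hb using 1
      rw [inv_mul_eq_iff_eq_mul] at hab
      rw [mul_assoc k, hab]
      group
    refine H1.trans ?_
    simpa using H2.translate k⁻¹

end IsStronglyAsyncCosetAutomatic

/-! ### Multiples of crossover and stability constants -/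

section Multiples

/-- Split `g = a * b` and insert a representative `r` of the coset of `p * a`; the crossover element
is then a product of two shorter ones. The case `n = 0` has to be excluded: two words of `L` may
represent different elements of the same coset. -/
theorem HasLimitedCrossoverWith.mul {G : Type*} [Group G] {ι : Type*} {x : ι → G}
    {L : Language (ι × Bool)} {Y Z : Set G} {k : ℕ} (hk : HasLimitedCrossoverWith k x L Y Z)
    (hL : IsCosetLanguage x (Subgroup.closure Y) L) (n : ℕ) (hn : n ≠ 0) :
    HasLimitedCrossoverWith (n * k) x L Y Z := by
  obtain ⟨n, rfl⟩ := Nat.exists_eq_succ_of_ne_zero hn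
  clear hn
  induction n with
  | zero => simpa using hk
  | succ n ih =>
    intro g hg p hp q hq hpq
    rw [Nat.succ_eq_add_one, add_mul, one_mul] at hg ⊢
    obtain ⟨a, b, ha, hb, rfl⟩ := hg.split
    obtain ⟨r, hr, h, hh, hrh⟩ := hL (evalWord x p * a)
    have e1 : evalWord x p * a * (evalWord x r)⁻¹ = h⁻¹ := by rw [hrh]; group
    have e2 : evalWord x p * (a * b) * (evalWord x q)⁻¹ =
        (evalWord x p * a * (evalWord x r)⁻¹) * (evalWord x r * b * (evalWord x q)⁻¹) := by group
    have m1 : evalWord x p * a * (evalWord x r)⁻¹ ∈ Subgroup.closure Y := e1 ▸ inv_mem hh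
    rw [e2] at hpq ⊢
    exact (ih a ha p hp r hr m1).mul
      (hk b hb r hr q hq ((Subgroup.mul_mem_cancel_left _ m1).1 hpq))

theorem wordLengthLE_mul_of_stable {G₁ G₂ : Type*} [Group G₁] [Group G₂] {H₁ : Subgroup G₁}
    {H₂ : Subgroup G₂} {φ : H₁ ≃* H₂} {Y₁ : Set G₁} {Y₂ : Set G₂} {μ : ℕ}
    (hY : Subgroup.closure Y₁ = H₁)
    (hφ : ∀ h : H₁, WordLengthLE Y₁ μ (h : G₁) → WordLengthLE Y₂ μ (φ h : G₂)) (n : ℕ)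
    (h : H₁) (hh : WordLengthLE Y₁ (n * μ) (h : G₁)) : WordLengthLE Y₂ (n * μ) (φ h : G₂) := by
  induction n generalizing h with
  | zero =>
    have : h = 1 := Subtype.ext (WordLengthLE.zero_iff.1 (by simpa using hh))
    simpa [this] using WordLengthLE.one Y₂ 0
  | succ n ih =>
    rw [add_mul, one_mul] at hh ⊢
    obtain ⟨a, b, ha, hb, hab⟩ := hh.split
    -- The pieces of a geodesic splitting over `Y₁` stay in `H₁`, so `φ` can be applied to each.
    have ha' : a ∈ H₁ := hY ▸ ha.mem_closure
    have hb' : b ∈ H₁ := hY ▸ hb.mem_closure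
    have : h = ⟨a, ha'⟩ * ⟨b, hb'⟩ := Subtype.ext hab
    rw [this, map_mul, Subgroup.coe_mul]
    exact (ih _ ha).mul (hφ _ hb)

end Multiples

/-! ### Regular languages -/

section Regular

variable {E : Type*} {A : E → Type*} {B : Type*}

/-- The words obtained by following a walk `i₀, i₁, …, iₖ` with respect to the relation `rel` that
ends in `F`, and by concatenating words of `R i₀`, `R i₁`, …, `R iₖ` (over their own alphabets),
with the labels of `i₁, …, iₖ` in between. -/
inductive ConcatWord (R : ∀ i, Language (A i)) (lift : ∀ i, A i → B) (label : E → Option B)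
    (rel : E → E → Prop) (F : Set E) : E → List B → Prop
  | last {i : E} {p : List (A i)} : p ∈ R i → i ∈ F → ConcatWord R lift label rel F i (p.map (lift i))
  | step {i j : E} {p : List (A i)} {q : List B} : p ∈ R i → rel i j →
      ConcatWord R lift label rel F j q →
      ConcatWord R lift label rel F i (p.map (lift i) ++ ((label j).toList ++ q))

theorem List.reduceOption_cons (o : Option B) (l : List (Option B)) :
    (o :: l).reduceOption = o.toList ++ l.reduceOption := by
  cases o <;> simp

/-- An ε-automaton runs the automaton of `R i`; from an accepting state it may jump to the start
state for some `j` related to `i`, reading `label j`, or nothing if there is no label. -/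
theorem isRegular_concatWord [Finite E] {R : ∀ i, Language (A i)} (hR : ∀ i, (R i).IsRegular)
    (lift : ∀ i, A i → B) (label : E → Option B) (rel : E → E → Prop) (F : Set E) (i₀ : E) :
    Language.IsRegular ({p | ConcatWord R lift label rel F i₀ p} : Language B) := by
  choose σ fσ M hM using hR
  let N : εNFA B (Σ i, σ i) :=
    { step := fun s o => {t | (∃ a, o = some (lift s.1 a) ∧ t = ⟨s.1, (M s.1).step s.2 a⟩) ∨
        (s.2 ∈ (M s.1).accept ∧ rel s.1 t.1 ∧ o = label t.1 ∧ t.2 = (M t.1).start)}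
      start := {⟨i₀, (M i₀).start⟩}
      accept := {s | s.1 ∈ F ∧ s.2 ∈ (M s.1).accept} }
  have run : ∀ i (p : List (A i)) (s : σ i),
      N.IsPath ⟨i, s⟩ ⟨i, (M i).evalFrom s p⟩ (p.map fun a => some (lift i a)) := by
    intro i p
    induction p with
    | nil => exact fun s => .nil _
    | cons a p ih => exact fun s => .cons _ _ _ _ _ (Or.inl ⟨a, rfl, rfl⟩) (ih _)
  have red : ∀ i (p : List (A i)),
      (p.map fun a => some (lift i a)).reduceOption = p.map (lift i) := by
    intro i p
    induction p with
    | nil => rfl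
    | cons a p ih => simpa using ih
  -- From an arbitrary state, what is still to be read is the rest of the current word, followed
  -- either by nothing or by a word of the language for some next index.
  have of_path : ∀ s t y, N.IsPath s t y → t ∈ N.accept →
      (∃ p, (M s.1).evalFrom s.2 p ∈ (M s.1).accept ∧ s.1 ∈ F ∧
        y.reduceOption = p.map (lift s.1)) ∨
      (∃ p j q, (M s.1).evalFrom s.2 p ∈ (M s.1).accept ∧ rel s.1 j ∧
        ConcatWord R lift label rel F j q ∧
        y.reduceOption = p.map (lift s.1) ++ ((label j).toList ++ q)) := by
    intro s t y H ht
    induction H with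
    | nil s => exact Or.inl ⟨[], ht.2, ht.1, rfl⟩
    | cons t s u o y hst _ ih =>
      rcases hst with ⟨a, rfl, rfl⟩ | ⟨h1, h2, rfl, h3⟩
      · rcases ih ht with ⟨p, hp, hF, e⟩ | ⟨p, j, q, hp, hj, hq, e⟩
        · exact Or.inl ⟨a :: p, hp, hF, by simp [e]⟩
        · exact Or.inr ⟨a :: p, j, q, hp, hj, hq, by simp [e]⟩
      · right
        rw [h3] at ih
        rcases ih ht with ⟨p, hp, hF, e⟩ | ⟨p, j, q, hp, hj, hq, e⟩
        · have hp' : p ∈ R t.1 := hM t.1 ▸ hp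
          exact ⟨[], t.1, _, h1, h2, .last hp' hF, by simp [List.reduceOption_cons, e]⟩
        · have hp' : p ∈ R t.1 := hM t.1 ▸ hp
          exact ⟨[], t.1, _, h1, h2, .step hp' hj hq, by simp [List.reduceOption_cons, e]⟩
  have to_path : ∀ i q, ConcatWord R lift label rel F i q →
      ∃ t y, N.IsPath ⟨i, (M i).start⟩ t y ∧ t ∈ N.accept ∧ y.reduceOption = q := by
    intro i q H
    induction H with
    | @last i p hp hi =>
      rw [← hM i] at hp
      exact ⟨_, _, run i p _, ⟨hi, hp⟩, red i p⟩
    | @step i j p q hp hj hq ih =>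
      rw [← hM i] at hp
      obtain ⟨t, y, H, ht, e⟩ := ih
      refine ⟨t, _, (N.isPath_append).2 ⟨_, run i p _, .cons ⟨j, (M j).start⟩ _ _ (label j) y
        (Or.inr ⟨hp, hj, rfl, rfl⟩) H⟩, ht, ?_⟩
      rw [List.reduceOption_append, red, List.reduceOption_cons, e]
  have hfin : Finite (Σ i, σ i) := inferInstance
  refine Language.isRegular_iff.2 ⟨_, Fintype.ofFinite _, N.toNFA.toDFA, ?_⟩
  rw [NFA.toDFA_correct, εNFA.toNFA_correct]
  ext q
  rw [εNFA.mem_accepts_iff_exists_path]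
  constructor
  · rintro ⟨s, t, y, rfl, ht, rfl, H⟩
    rcases of_path _ _ _ H ht with ⟨p, hp, hF, e⟩ | ⟨p, j, q, hp, hj, hq, e⟩
    · have hp' : p ∈ R i₀ := hM i₀ ▸ hp
      rw [e]
      exact ConcatWord.last hp' hF
    · have hp' : p ∈ R i₀ := hM i₀ ▸ hp
      rw [e]
      exact ConcatWord.step hp' hj hq
  · intro hq
    obtain ⟨t, y, H, ht, e⟩ := to_path _ _ hq
    exact ⟨_, t, y, rfl, ht, e, H⟩

/-- The automaton remembers the current group element as long as it lies in the finite set `D`;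
`none` is the dead state entered on leaving `D`. -/
theorem isRegular_setOf_evalWord_take_mem {G ι : Type*} [Group G] (x : ι → G) {D : Set G}
    (hD : D.Finite) (S : Set G) :
    Language.IsRegular ({p | (∀ n, evalWord x (p.take n) ∈ D) ∧ evalWord x p ∈ S} :
      Language (ι × Bool)) := by
  classical
  have : Finite D := hD
  let M : DFA (ι × Bool) (Option D) :=
    { step := fun s a => s.bind fun g =>
        if h : (g : G) * evalWord x [a] ∈ D then some ⟨_, h⟩ else none
      start := if h : (1 : G) ∈ D then some ⟨1, h⟩ else none
      accept := {s | ∃ g : D, s = some g ∧ (g : G) ∈ S} }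
  have step_some : ∀ (g : D) a, M.step (some g) a =
      if h : (g : G) * evalWord x [a] ∈ D then some ⟨_, h⟩ else none := fun g a => rfl
  have step_none : ∀ a, M.step none a = none := fun a => rfl
  have key : ∀ p, (∀ n, evalWord x (p.take n) ∈ D) ∧ M.eval p = (if h : evalWord x p ∈ D then
      some ⟨_, h⟩ else none) ∨ (¬ ∀ n, evalWord x (p.take n) ∈ D) ∧ M.eval p = none := by
    intro p
    induction p using List.reverseRecOn with
    | nil =>
      by_cases h : (1 : G) ∈ D
      · exact Or.inl ⟨by simpa, rfl⟩
      · exact Or.inr ⟨by simpa, dif_neg h⟩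
    | append_singleton p a ih =>
      rw [DFA.eval_append_singleton]
      have hpre : (∀ n, evalWord x ((p ++ [a]).take n) ∈ D) → ∀ n, evalWord x (p.take n) ∈ D := by
        intro H n
        have := H (min n p.length)
        rw [List.take_append_of_le_length (min_le_right _ _)] at this
        rcases le_total n p.length with h | h
        · rwa [min_eq_left h] at this
        · rw [min_eq_right h, List.take_length] at this
          rwa [List.take_of_length_le h]
      rcases ih with ⟨h1, h2⟩ | ⟨h1, h2⟩
      · have hp : evalWord x p ∈ D := by simpa using h1 p.length
        by_cases h : evalWord x (p ++ [a]) ∈ D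
        · refine Or.inl ⟨fun n => ?_, ?_⟩
          · rcases le_or_gt n p.length with hn | hn
            · rw [List.take_append_of_le_length hn]
              exact h1 n
            · rwa [List.take_of_length_le (by simpa using hn)]
          · have h' := h
            rw [evalWord_append] at h'
            rw [h2, dif_pos hp, step_some, dif_pos h', dif_pos h]
            simp only [evalWord_append]
        · refine Or.inr ⟨fun H => h (by simpa only [List.take_length] using H (p ++ [a]).length), ?_⟩
          rw [evalWord_append] at h
          rw [h2, dif_pos hp, step_some, dif_neg h]
      · exact Or.inr ⟨fun H => h1 (hpre H), by rw [h2, step_none]⟩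
  refine Language.isRegular_iff.2 ⟨_, Fintype.ofFinite _, M, ?_⟩
  ext p
  rw [DFA.mem_accepts]
  have hsub : (∀ n, evalWord x (p.take n) ∈ D) → evalWord x p ∈ D := fun H => by
    simpa using H p.length
  rcases key p with ⟨h1, h2⟩ | ⟨h1, h2⟩
  · rw [h2, dif_pos (hsub h1)]
    constructor
    · rintro ⟨g, hg, hS⟩
      cases hg
      exact ⟨h1, hS⟩
    · exact fun H => ⟨_, rfl, H.2⟩
  · rw [h2]
    constructor
    · rintro ⟨g, hg, hS⟩
      cases hg
    · exact fun H => absurd H.1 h1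

theorem Interleaved.dist_of_prefix {G ι : Type*} [Group G] {x : ι → G} {K : ℕ} {g h : G}
    {p q : List (ι × Bool)} (H : Interleaved x K g h p q) (hq : q = []) (n : ℕ) :
    CayleyDistLE x K (g * evalWord x (p.take n)) h := by
  induction H generalizing n with
  | nil h => simpa using h
  | left h _ ih =>
    rcases n with _ | n
    · simpa using h
    · rw [List.take_succ_cons, evalWord_cons, ← mul_assoc]
      exact ih hq n
  | right => cases hq

/-- A word of `L` representing `h ∈ H` fellow travels with the empty word based at `h`. Its prefixes
and 1 are thus all within `K` of `h`, hence the prefixes lie in the ball of radius `K + K` about 1.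
-/
theorem IsStronglyAsyncCosetAutomatic.isRegular_inter_subgroup {G ι : Type*} [Group G]
    {x : ι → G} {H : Subgroup G} {L : Language (ι × Bool)}
    (hL : IsStronglyAsyncCosetAutomatic x H L) (hnil : [] ∈ L) :
    Language.IsRegular (L ⊓ {p | evalWord x p ∈ H} : Language (ι × Bool)) := by
  obtain ⟨K, hK⟩ := hL.exists_interleaved
  have := hL.finite_generators
  have hD := finite_setOf_wordLengthLE (Set.finite_range x) (K + K)
  have := hL.isRegular.inf (isRegular_setOf_evalWord_take_mem x hD (H : Set G))
  convert this using 1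
  refine le_antisymm (fun p hp => ⟨hp.1, fun n => ?_, hp.2⟩) fun p hp => ⟨hp.1, hp.2.2⟩
  have h1 : Interleaved x K 1 (evalWord x p) p [] :=
    hK p hp.1 [] hnil _ hp.2 (by simpa using CayleyDistLE.refl _ _ _)
  have h2 := h1.dist_of_prefix rfl n
  have h3 := h1.dist.trans h2.symm
  simpa [CayleyDistLE] using h3

end Regular

namespace GraphOfGroups

section

variable {V : Type u} [Quiver.{v} V]

theorem finite_total (V : Type u) [Quiver.{v} V] [Finite V] [∀ a b : V, Finite (a ⟶ b)] :
    Finite (Quiver.Total V) :=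
  Finite.of_injective (β := Σ a b : V, (a ⟶ b)) (fun e => ⟨e.left, e.right, e.hom⟩) (by
    rintro ⟨a, b, e⟩ ⟨a', b', e'⟩ h
    cases h
    rfl)

/-! ### Labelled paths -/

/-- A path in the graph, together with a label in `W b` for each edge with target `b`. -/
inductive LabelledPath (W : V → Type*) : V → V → Type _
  | nil (a : V) : LabelledPath W a a
  | cons {a b c : V} (e : a ⟶ b) (s : W b) (p : LabelledPath W b c) : LabelledPath W a c

namespace LabelledPath

variable {W : V → Type*}

/-- The first edge of a path. -/
def firstEdge : ∀ {a c : V}, LabelledPath W a c → Option (Σ b, a ⟶ b)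
  | _, _, nil _ => none
  | _, _, cons e _ _ => some ⟨_, e⟩

/-- The number of edges. -/
def length : ∀ {a c : V}, LabelledPath W a c → ℕ
  | _, _, nil _ => 0
  | _, _, cons _ _ p => p.length + 1

/-- Concatenation of paths. -/
def comp : ∀ {a b c : V}, LabelledPath W a b → LabelledPath W b c → LabelledPath W a c
  | _, _, _, nil _, q => q
  | _, _, _, cons e s p, q => cons e s (p.comp q)

@[simp] theorem firstEdge_nil (a : V) : (nil (W := W) a).firstEdge = none := rfl

@[simp] theorem firstEdge_cons {a b c : V} (e : a ⟶ b) (s : W b) (p : LabelledPath W b c) :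
    (cons e s p).firstEdge = some ⟨b, e⟩ := rfl

theorem length_comp {a b c : V} (p : LabelledPath W a b) (q : LabelledPath W b c) :
    (p.comp q).length = p.length + q.length := by
  induction p with
  | nil => simp [comp, length]
  | cons e s p ih =>
    simp [comp, length, ih]
    omega

theorem eq_cons_of_firstEdge {a b c : V} {p : LabelledPath W a c} {e : a ⟶ b}
    (h : p.firstEdge = some ⟨b, e⟩) : ∃ s p', p = cons e s p' := by
  cases p with
  | nil => cases h
  | cons e' s p' =>
    cases h
    exact ⟨s, p', rfl⟩

end LabelledPath

end

variable {V : Type u} [Quiver.{v} V] [Quiver.HasInvolutiveReverse V]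

/-! ### Relations in the fundamental group -/

section Relations

variable (𝒢 : GraphOfGroups.{u, v, w} V) {a b c : V} (e : a ⟶ b)

open Classical in
/-- The isomorphism `φ_e`, extended by `1` to a map between vertex groups. -/
noncomputable def edgeMap (g : 𝒢.vertexGroup b) : 𝒢.vertexGroup a :=
  if h : g ∈ 𝒢.edgeGroup e then 𝒢.φ e ⟨g, h⟩ else 1

variable {𝒢} {e} {g h : 𝒢.vertexGroup b}

theorem edgeMap_of_mem (hg : g ∈ 𝒢.edgeGroup e) : 𝒢.edgeMap e g = 𝒢.φ e ⟨g, hg⟩ := dif_pos hg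

theorem edgeMap_mem (e : a ⟶ b) (g : 𝒢.vertexGroup b) :
    𝒢.edgeMap e g ∈ 𝒢.edgeGroup (Quiver.reverse e) := by
  by_cases hg : g ∈ 𝒢.edgeGroup e
  · rw [edgeMap_of_mem hg]
    exact SetLike.coe_mem _
  · rw [edgeMap, dif_neg hg]
    exact one_mem _

theorem edgeMap_reverse_edgeMap (hg : g ∈ 𝒢.edgeGroup e) :
    𝒢.edgeMap (Quiver.reverse e) (𝒢.edgeMap e g) = g := by
  rw [edgeMap_of_mem (edgeMap_mem e g)]
  simp only [edgeMap_of_mem hg]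
  exact 𝒢.φ_reverse e ⟨g, hg⟩

theorem edgeMap_edgeMap_reverse {g : 𝒢.vertexGroup a}
    (hg : g ∈ 𝒢.edgeGroup (Quiver.reverse e)) :
    𝒢.edgeMap e (𝒢.edgeMap (Quiver.reverse e) g) = g := by
  simpa using edgeMap_reverse_edgeMap hg

theorem edgeMap_reverse_mem (e : a ⟶ b) (g : 𝒢.vertexGroup a) :
    𝒢.edgeMap (Quiver.reverse e) g ∈ 𝒢.edgeGroup e := by
  simpa using edgeMap_mem (Quiver.reverse e) g

theorem edgeMap_mul (hg : g ∈ 𝒢.edgeGroup e) (hh : h ∈ 𝒢.edgeGroup e) :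
    𝒢.edgeMap e (g * h) = 𝒢.edgeMap e g * 𝒢.edgeMap e h := by
  rw [edgeMap_of_mem hg, edgeMap_of_mem hh, edgeMap_of_mem (mul_mem hg hh), ← Subgroup.coe_mul,
    ← map_mul]
  rfl

variable (T : WideSubquiver V)

theorem stable_of_mem (he : e ∈ T a b) : 𝒢.stable T e = 1 :=
  (QuotientGroup.eq_one_iff _).2 (Subgroup.subset_normalClosure (Relator.tree e he))

theorem stable_reverse (e : a ⟶ b) :
    𝒢.stable T (Quiver.reverse e) = (𝒢.stable T e)⁻¹ := by
  rw [eq_inv_iff_mul_eq_one]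
  exact (QuotientGroup.eq_one_iff _).2 (Subgroup.subset_normalClosure (Relator.inv e))

theorem stable_mul_ofVertex (hg : g ∈ 𝒢.edgeGroup e) :
    𝒢.stable T e * 𝒢.ofVertex T b g = 𝒢.ofVertex T a (𝒢.edgeMap e g) * 𝒢.stable T e := by
  rw [← mul_inv_eq_iff_eq_mul, ← mul_inv_eq_one, edgeMap_of_mem hg]
  exact (QuotientGroup.eq_one_iff _).2 (Subgroup.subset_normalClosure (Relator.conj e ⟨g, hg⟩))

theorem closure_range_ofVertex_stable (𝒢 : GraphOfGroups.{u, v, w} V) (T : WideSubquiver V)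
    (K : Subgroup (𝒢.FundamentalGroup T)) (h1 : ∀ a g, 𝒢.ofVertex T a g ∈ K)
    (h2 : ∀ {a b : V} (e : a ⟶ b), 𝒢.stable T e ∈ K) : K = ⊤ := by
  have key : K.comap (QuotientGroup.mk' (Subgroup.normalClosure {r | Relator 𝒢 T r})) = ⊤ := by
    rw [eq_top_iff]
    rintro x -
    induction x using Monoid.Coprod.induction_on with
    | inl m =>
      induction m using Monoid.CoprodI.induction_on with
      | one => simp
      | of i m => exact h1 i m
      | mul x y hx hy =>
        rw [map_mul]
        exact mul_mem hx hy
    | inr n =>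
      induction n using FreeGroup.induction_on with
      | C1 => simp
      | of x => exact h2 x.hom
      | inv_of x hx =>
        rw [map_inv]
        exact inv_mem hx
      | mul x y hx hy =>
        rw [map_mul]
        exact mul_mem hx hy
    | mul x y hx hy => exact mul_mem hx hy
  rw [eq_top_iff]
  rintro x -
  obtain ⟨y, rfl⟩ := QuotientGroup.mk'_surjective _ x
  exact (Subgroup.mem_comap.1 (key ▸ Subgroup.mem_top y) : _)

end Relations

/-! ### Paths labelled by words -/

variable {𝒢 : GraphOfGroups.{u, v, w} V} {X : ∀ a, Finset (𝒢.vertexGroup a)}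
  {L : ∀ {a b : V}, (a ⟶ b) → Language (X b × Bool)} {T : WideSubquiver V}

/-- A path whose edges are labelled by words over the generators of the groups at their targets. -/
abbrev WordPath (𝒢 : GraphOfGroups.{u, v, w} V) (X : ∀ a, Finset (𝒢.vertexGroup a)) (a c : V) :=
  LabelledPath (fun b => List (X b × Bool)) a c

/-- A word over the generators of a vertex group as a word over `Gen`. -/
def vertexWord (X : ∀ a, Finset (𝒢.vertexGroup a)) (T : WideSubquiver V) (a : V)
    (l : List (X a × Bool)) : List (𝒢.Gen X T × Bool) :=
  l.map (Prod.map (fun y => Sum.inl ⟨a, y⟩) id)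

open Classical in
/-- The deflation of the letter `s_e`. -/
noncomputable def edgeLetter (X : ∀ a, Finset (𝒢.vertexGroup a)) (T : WideSubquiver V)
    (e : Quiver.Total V) : Option (𝒢.Gen X T × Bool) :=
  if h : e.hom ∉ T e.left e.right then some (Sum.inr ⟨e, h⟩, true) else none

theorem deflate_append (p q : List (𝒢.FullGen X × Bool)) :
    𝒢.deflate X T (p ++ q) = 𝒢.deflate X T p ++ 𝒢.deflate X T q := by
  simp [deflate]

theorem deflate_liftWord (a : V) (l : List (X a × Bool)) :
    𝒢.deflate X T (𝒢.liftWord X a l) = vertexWord X T a l := by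
  simp [deflate, liftWord, vertexWord, List.filterMap_map]

theorem deflate_toWord (s : 𝒢.Syllable X) :
    𝒢.deflate X T s.toWord =
      (edgeLetter X T ⟨s.src, s.tgt, s.edge⟩).toList ++ vertexWord X T s.tgt s.word := by
  rw [Syllable.toWord, ← List.singleton_append, deflate_append, deflate_liftWord]
  by_cases h : s.edge ∈ T s.src s.tgt <;> simp [deflate, edgeLetter, h]

theorem evalWord_vertexWord (a : V) (l : List (X a × Bool)) :
    evalWord (𝒢.genMap X T) (vertexWord X T a l) =
      𝒢.ofVertex T a (evalWord (𝒢.gens X a) l) :=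
  map_evalWord (x := 𝒢.gens X a) (x' := 𝒢.genMap X T) (𝒢.ofVertex T a) (fun _ => rfl) l

theorem evalWord_edgeLetter (e : Quiver.Total V) :
    evalWord (𝒢.genMap X T) (edgeLetter X T e).toList = 𝒢.stable T e.hom := by
  by_cases h : e.hom ∈ T e.left e.right
  · simp [edgeLetter, h, stable_of_mem]
  · simp [edgeLetter, h, evalWord, genMap]

namespace WordPath

/-- The word over `Gen` spelled by a path. -/
noncomputable def word (T : WideSubquiver V) :
    ∀ {a c : V}, WordPath 𝒢 X a c → List (𝒢.Gen X T × Bool)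
  | _, _, .nil _ => []
  | _, _, .cons e s p => (edgeLetter X T ⟨_, _, e⟩).toList ++ vertexWord X T _ s ++ word T p

/-- The element of the fundamental group represented by a path. -/
def value (T : WideSubquiver V) : ∀ {a c : V}, WordPath 𝒢 X a c → 𝒢.FundamentalGroup T
  | _, _, .nil _ => 1
  | _, _, .cons e s p => 𝒢.stable T e * 𝒢.ofVertex T _ (evalWord (𝒢.gens X _) s) * value T p

/-- The labels lie in the coset languages, and there is no backtracking `s_e u s_ē` with `u` in the
edge group. -/
def IsReduced (L : ∀ {a b : V}, (a ⟶ b) → Language (X b × Bool)) :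
    ∀ {a c : V}, WordPath 𝒢 X a c → Prop
  | _, _, .nil _ => True
  | a, _, .cons e s p => s ∈ L e ∧ (p.firstEdge = some ⟨a, Quiver.reverse e⟩ →
      evalWord (𝒢.gens X _) s ∉ 𝒢.edgeGroup e) ∧ IsReduced L p

/-- If the last edge is in the tree, then its label does not represent an element of the edge
group. -/
def IsFinal (T : WideSubquiver V) : ∀ {a c : V}, WordPath 𝒢 X a c → Prop
  | _, _, .nil _ => True
  | _, _, .cons e s p => (p.firstEdge = none → e ∈ T _ _ →
      evalWord (𝒢.gens X _) s ∉ 𝒢.edgeGroup e) ∧ IsFinal T p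

/-- The syllables of a path. -/
def syllables : ∀ {a c : V}, WordPath 𝒢 X a c → List (𝒢.Syllable X)
  | _, _, .nil _ => []
  | _, _, .cons e s p => ⟨_, _, e, s⟩ :: syllables p

theorem evalWord_word : ∀ {a c : V} (p : WordPath 𝒢 X a c),
    evalWord (𝒢.genMap X T) (word T p) = value T p
  | _, _, .nil _ => rfl
  | _, _, .cons e s p => by
    rw [word, value, evalWord_append, evalWord_append, evalWord_edgeLetter, evalWord_vertexWord,
      evalWord_word p]

theorem deflate_syllables : ∀ {a c : V} (p : WordPath 𝒢 X a c),
    𝒢.deflate X T ((syllables p).flatMap Syllable.toWord) = word T p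
  | _, _, .nil _ => rfl
  | _, _, .cons e s p => by
    rw [syllables, List.flatMap_cons, deflate_append, deflate_syllables p, deflate_toWord, word]

end WordPath

theorem isHigginsSequence_nil (a : V) : 𝒢.IsHigginsSequence X T L a [] :=
  ⟨.nil, by simp, by simp, .nil, by simp⟩

theorem isHigginsSequence_cons {a : V} {s : 𝒢.Syllable X} {l : List (𝒢.Syllable X)} :
    𝒢.IsHigginsSequence X T L a (s :: l) ↔ s.src = a ∧ s.word ∈ L s.edge ∧
      (∀ t ∈ l.head?, s.IsReverse t → ¬ s.InEdgeGroup) ∧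
      (l = [] → s.edge ∈ T s.src s.tgt → ¬ s.InEdgeGroup) ∧
      𝒢.IsHigginsSequence X T L s.tgt l := by
  constructor
  · rintro ⟨h1, h2, h3, h4, h5⟩
    rw [List.isChain_cons] at h1 h4
    refine ⟨h2 s (by simp), h3 s (by simp), h4.1, ?_, h1.2, fun t ht => (h1.1 t ht).symm,
      fun t ht => h3 t (by simp [ht]), h4.2, fun t ht => h5 t ?_⟩
    · rintro rfl
      exact h5 s (by simp)
    · rw [List.getLast?_cons, Option.mem_def.1 ht]
      simp
  · rintro ⟨h1, h2, h3, h4, h5⟩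
    refine ⟨List.isChain_cons.2 ⟨fun t ht => (h5.start t ht).symm, h5.isPath⟩, by simpa using h1,
      ?_, List.isChain_cons.2 ⟨h3, h5.reduced⟩, ?_⟩
    · simpa [h2] using h5.mem_lang
    · intro t ht
      rcases List.eq_nil_or_concat l with rfl | ⟨l', r, rfl⟩
      · simp at ht
        subst ht
        exact h4 rfl
      · exact h5.last t (by simpa [List.getLast?_cons] using ht)

theorem WordPath.isHigginsSequence_syllables {a c : V} (p : WordPath 𝒢 X a c) :
    𝒢.IsHigginsSequence X T L a (syllables p) ↔ IsReduced L p ∧ IsFinal T p := by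
  induction p with
  | nil a => simp [syllables, isHigginsSequence_nil, IsReduced, IsFinal]
  | cons e s p ih =>
    rw [syllables, isHigginsSequence_cons, ih, IsReduced, IsFinal]
    cases p with
    | nil b => simp [syllables, Syllable.InEdgeGroup, IsReduced, IsFinal]
    | cons f t p =>
      simp only [syllables, Syllable.InEdgeGroup, Syllable.IsReverse, List.head?_cons,
        Option.mem_def, Option.some.injEq, forall_eq', LabelledPath.firstEdge_cons,
        Sigma.mk.injEq, Quiver.Total.mk.injEq, true_and, reduceCtorEq, false_implies,
        and_assoc]

theorem exists_syllables_eq {l : List (𝒢.Syllable X)} {a : V}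
    (h : 𝒢.IsHigginsSequence X T L a l) :
    ∃ (c : V) (p : WordPath 𝒢 X a c), p.syllables = l := by
  induction l generalizing a with
  | nil => exact ⟨a, .nil a, rfl⟩
  | cons s l ih =>
    obtain ⟨rfl, -, -, -, h'⟩ := isHigginsSequence_cons.1 h
    obtain ⟨c, p, rfl⟩ := ih h'
    exact ⟨c, .cons s.edge s.word p, rfl⟩

theorem mem_higginsCosetLanguage_iff {a₀ b₀ : V} {e₀ : a₀ ⟶ b₀} {q : List (𝒢.Gen X T × Bool)} :
    q ∈ 𝒢.higginsCosetLanguage X T L e₀ ↔ ∃ s ∈ L e₀, ∃ (c : V) (p : WordPath 𝒢 X b₀ c),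
      p.IsReduced L ∧ p.IsFinal T ∧ q = vertexWord X T b₀ s ++ p.word T := by
  constructor
  · rintro ⟨_, ⟨s, hs, l, hl, rfl⟩, rfl⟩
    obtain ⟨c, p, rfl⟩ := exists_syllables_eq hl
    obtain ⟨h1, h2⟩ := p.isHigginsSequence_syllables.1 hl
    exact ⟨s, hs, c, p, h1, h2, by
      rw [deflate_append, deflate_liftWord, WordPath.deflate_syllables]⟩
  · rintro ⟨s, hs, c, p, h1, h2, rfl⟩
    exact ⟨_, ⟨s, hs, _, p.isHigginsSequence_syllables.2 ⟨h1, h2⟩, rfl⟩, by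
      rw [deflate_append, deflate_liftWord, WordPath.deflate_syllables]⟩

/-! ### Regularity of the Higgins coset language -/

/-- The part of the coset language of `e` that consists of the words that represent elements of the
edge group, or of the words that do not; the whole language for `none`. -/
def splitLanguage (L : ∀ {a b : V}, (a ⟶ b) → Language (X b × Bool)) :
    ∀ i : Quiver.Total V × Option Bool, Language (X i.1.right × Bool)
  | (e, none) => L e.hom
  | (e, some true) => L e.hom ⊓ {s | evalWord (𝒢.gens X e.right) s ∈ 𝒢.edgeGroup e.hom}
  | (e, some false) => L e.hom ⊓ {s | evalWord (𝒢.gens X e.right) s ∈ 𝒢.edgeGroup e.hom}ᶜ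

/-- The edge `f` may follow the edge `e`. -/
def splitRel (i j : Quiver.Total V × Option Bool) : Prop :=
  j.2 ≠ none ∧ j.1.left = i.1.right ∧
    (i.2 = some true → j.1 ≠ ⟨i.1.right, i.1.left, Quiver.reverse i.1.hom⟩)

/-- Makes the conditions local: the flag attached to an edge records whether its label lies in the
edge group. The flag `none` marks the unrestricted initial word and is never re-entered. -/
theorem mem_higginsCosetLanguage_iff_concatWord {a₀ b₀ : V} {e₀ : a₀ ⟶ b₀}
    {q : List (𝒢.Gen X T × Bool)} :
    q ∈ 𝒢.higginsCosetLanguage X T L e₀ ↔ ConcatWord (splitLanguage L)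
      (fun i => Prod.map (fun y => Sum.inl ⟨i.1.right, y⟩) id) (fun i => edgeLetter X T i.1)
      splitRel {i | i.2 = some true → i.1.hom ∉ T i.1.left i.1.right}
      (⟨a₀, b₀, e₀⟩, none) q := by
  rw [mem_higginsCosetLanguage_iff]
  constructor
  · rintro ⟨s, hs, c, p, h1, h2, rfl⟩
    -- The flag `some true` on the preceding edge is a promise about the rest of the path: it does
    -- not backtrack, and it is nonempty if that edge is in the tree.
    have key : ∀ {b c : V} (p : WordPath 𝒢 X b c), p.IsReduced L → p.IsFinal T →
        ∀ {a : V} (e : a ⟶ b) (o : Option Bool), ∀ s ∈ splitLanguage L (⟨a, b, e⟩, o),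
        (o = some true → p.firstEdge ≠ some ⟨a, Quiver.reverse e⟩ ∧
          (p.firstEdge = none → e ∉ T a b)) →
        ConcatWord (splitLanguage L)
          (fun i => Prod.map (fun y => Sum.inl ⟨i.1.right, y⟩) id) (fun i => edgeLetter X T i.1)
          splitRel {i | i.2 = some true → i.1.hom ∉ T i.1.left i.1.right}
          (⟨a, b, e⟩, o) (vertexWord X T b s ++ p.word T) := by
      clear h1 h2 p hs s
      intro b c p h1 h2
      induction p with
      | nil b =>
        intro a e o s hs ho
        simp only [WordPath.word, List.append_nil]
        exact .last hs fun h => (ho h).2 rfl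
      | @cons b d c f t p ih =>
        intro a e o s hs ho
        obtain ⟨ht, hr, h1⟩ := h1
        obtain ⟨hf, h2⟩ := h2
        by_cases hm : evalWord (𝒢.gens X d) t ∈ 𝒢.edgeGroup f
        · have := ih h1 h2 f (some true) t ⟨ht, hm⟩
            fun _ => ⟨fun h => hr h hm, fun h h' => hf h h' hm⟩
          rw [WordPath.word, List.append_assoc]
          refine ConcatWord.step (j := (⟨b, d, f⟩, some true)) hs ⟨by simp, rfl, ?_⟩ this
          rintro h h'
          refine (ho h).1 ?_
          cases h'
          rfl
        · have := ih h1 h2 f (some false) t ⟨ht, hm⟩ (by simp)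
          rw [WordPath.word, List.append_assoc]
          refine ConcatWord.step (j := (⟨b, d, f⟩, some false)) hs ⟨by simp, rfl, ?_⟩ this
          rintro h h'
          refine (ho h).1 ?_
          cases h'
          rfl
    exact key p h1 h2 e₀ none s hs (by simp)
  · intro H
    have key : ∀ i q, ConcatWord (splitLanguage L)
        (fun i => Prod.map (fun y => Sum.inl ⟨i.1.right, y⟩) id) (fun i => edgeLetter X T i.1)
        splitRel {i | i.2 = some true → i.1.hom ∉ T i.1.left i.1.right} i q →
        ∃ s ∈ splitLanguage L i, ∃ (c : V) (p : WordPath 𝒢 X i.1.right c), p.IsReduced L ∧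
          p.IsFinal T ∧ (i.2 = some true →
            p.firstEdge ≠ some ⟨i.1.left, Quiver.reverse i.1.hom⟩ ∧
            (p.firstEdge = none → i.1.hom ∉ T i.1.left i.1.right)) ∧
          q = vertexWord X T i.1.right s ++ p.word T := by
      intro i q H
      induction H with
      | @last i s hs hi =>
        refine ⟨s, hs, _, .nil _, trivial, trivial, fun h => ⟨by simp, fun _ => hi h⟩, ?_⟩
        simp [WordPath.word, vertexWord]
      | @step i j s q hs hij _ ih =>
        obtain ⟨t, ht, c, p, h1, h2, h3, rfl⟩ := ih
        obtain ⟨⟨a, b, e⟩, o⟩ := i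
        obtain ⟨⟨a', b', f⟩, o'⟩ := j
        obtain ⟨h4, h5, h6⟩ := hij
        dsimp only at *
        subst h5
        have ht' : t ∈ L f ∧ (o' = some true ∨ evalWord (𝒢.gens X b') t ∉ 𝒢.edgeGroup f) := by
          rcases o' with _ | _ | _
          · exact absurd rfl h4
          · exact ⟨ht.1, Or.inr ht.2⟩
          · exact ⟨ht.1, Or.inl rfl⟩
        refine ⟨s, hs, c, .cons f t p, ⟨ht'.1, fun h => ?_, h1⟩, ⟨fun h h' => ?_, h2⟩,
          fun h => ⟨fun h' => h6 h ?_, by simp⟩, ?_⟩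
        · exact ht'.2.resolve_left fun h' => (h3 h').1 h
        · exact ht'.2.resolve_left fun ho => (h3 ho).2 h h'
        · cases h'
          rfl
        · simp [WordPath.word, vertexWord]
    obtain ⟨s, hs, c, p, h1, h2, -, h⟩ := key _ _ H
    exact ⟨s, hs, c, p, h1, h2, h⟩

theorem isRegular_higginsCosetLanguage [Finite V] [∀ a b : V, Finite (a ⟶ b)]
    (hL : ∀ {a b : V} (e : a ⟶ b),
      IsStronglyAsyncCosetAutomatic (𝒢.gens X b) (𝒢.edgeGroup e) (L e))
    (hnil : ∀ {a b : V} (e : a ⟶ b), [] ∈ L e) {a₀ b₀ : V} (e₀ : a₀ ⟶ b₀) :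
    (𝒢.higginsCosetLanguage X T L e₀).IsRegular := by
  have := finite_total V
  have hreg : ∀ i : Quiver.Total V × Option Bool, (splitLanguage L i).IsRegular := by
    rintro ⟨e, _ | _ | _⟩
    · exact (hL e.hom).isRegular
    · have h1 := (hL e.hom).isRegular.inf
        ((hL e.hom).isRegular_inter_subgroup (hnil e.hom)).compl
      convert h1 using 1
      refine Set.ext fun s => and_congr_right fun hs => ?_
      exact not_congr ⟨fun h => ⟨hs, h⟩, fun h => h.2⟩
    · exact (hL e.hom).isRegular_inter_subgroup (hnil e.hom)
  have := isRegular_concatWord hreg (fun i => Prod.map (fun y => (Sum.inl ⟨i.1.right, y⟩ : 𝒢.Gen X T)) id)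
    (fun i => edgeLetter X T i.1) splitRel
    {i | i.2 = some true → i.1.hom ∉ T i.1.left i.1.right} (⟨a₀, b₀, e₀⟩, none)
  exact (Set.ext fun q => mem_higginsCosetLanguage_iff_concatWord (L := L) :
    𝒢.higginsCosetLanguage X T L e₀ = _) ▸ this

end GraphOfGroups

namespace GraphOfGroups

/-! ### Potentials on a tree -/

section Potential

variable {V : Type u} [Quiver.{v} V] [Quiver.HasInvolutiveReverse V] {T : WideSubquiver V}

/-- The simple graph spanned by a set of edges. -/
abbrev spannedGraph (T : WideSubquiver V) : SimpleGraph V :=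
  SimpleGraph.fromRel fun a b : V => (T a b).Nonempty

theorem _root_.IsMaximalTree.nonempty_of_adj (hT : IsMaximalTree T) {a b : V}
    (h : (spannedGraph T).Adj a b) : (T a b).Nonempty := by
  obtain ⟨-, h | ⟨e, he⟩⟩ := (SimpleGraph.fromRel_adj _ _ _).1 h
  · exact h
  · exact ⟨_, hT.reverse_mem e he⟩

theorem _root_.IsMaximalTree.adj_of_mem (hT : IsMaximalTree T) {a b : V} {e : a ⟶ b}
    (he : e ∈ T a b) : (spannedGraph T).Adj a b := by
  refine (SimpleGraph.fromRel_adj _ _ _).2 ⟨?_, Or.inl ⟨e, he⟩⟩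
  rintro rfl
  simp [hT.no_loop] at he

/-- The composition of the bijections given along the edges of a walk. -/
noncomputable def walkEquiv {Ω : V → Type*} (hT : IsMaximalTree T)
    (σ : ∀ {a b : V}, (a ⟶ b) → (Ω b ≃ Ω a)) :
    ∀ {a b : V}, (spannedGraph T).Walk a b → (Ω b ≃ Ω a)
  | _, _, .nil => Equiv.refl _
  | _, _, .cons h p => (walkEquiv hT σ p).trans (σ (hT.nonempty_of_adj h).some)

theorem walkEquiv_concat {Ω : V → Type*} (hT : IsMaximalTree T)
    (σ : ∀ {a b : V}, (a ⟶ b) → (Ω b ≃ Ω a)) {a b c : V} (p : (spannedGraph T).Walk a b)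
    (h : (spannedGraph T).Adj b c) (e : b ⟶ c) (he : e ∈ T b c) :
    walkEquiv hT σ (p.concat h) = (σ e).trans (walkEquiv hT σ p) := by
  induction p with
  | nil =>
    have : (hT.nonempty_of_adj h).some = e :=
      hT.no_parallel _ _ (hT.nonempty_of_adj h).some_mem he
    simp only [SimpleGraph.Walk.concat_nil, walkEquiv, this]
    rfl
  | cons h' p ih =>
    rw [SimpleGraph.Walk.concat_cons, walkEquiv, ih h e he]
    rfl

/-- Compose the bijections along the tree path from `r`. For adjacent vertices one of the two tree
paths extends the other by the edge in question, which gives compatibility. -/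
theorem _root_.IsMaximalTree.exists_potential {Ω : V → Type*} (hT : IsMaximalTree T)
    (σ : ∀ {a b : V}, (a ⟶ b) → (Ω b ≃ Ω a))
    (hσ : ∀ {a b : V} (e : a ⟶ b), σ (Quiver.reverse e) = (σ e).symm) (r : V) :
    ∃ γ : ∀ a, Ω a ≃ Ω r, ∀ {a b : V} (e : a ⟶ b), e ∈ T a b → γ b = (σ e).trans (γ a) := by
  choose P hP using fun a => (hT.isTree.connected.preconnected r a).exists_isPath
  refine ⟨fun a => walkEquiv hT σ (P a), fun {a b} e he => ?_⟩
  have hab := hT.adj_of_mem he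
  dsimp only
  by_cases h : a ∈ (P b).support
  · rw [hT.isTree.isAcyclic.path_concat (hP a) (hP b) hab h, walkEquiv_concat hT σ _ _ e he]
  · have h' := hT.isTree.isAcyclic.mem_support_of_ne_mem_support_of_adj_of_isPath
      (hP a) (hP b) hab h
    rw [hT.isTree.isAcyclic.path_concat (hP b) (hP a) hab.symm h',
      walkEquiv_concat hT σ _ _ _ (hT.reverse_mem e he), hσ]
    ext n
    simp

end Potential

variable {V : Type u} [Quiver.{v} V] [Quiver.HasInvolutiveReverse V]
  {𝒢 : GraphOfGroups.{u, v, w} V} {T : WideSubquiver V}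

/-! ### Coset representatives -/

section Representatives

variable {a b : V}

open Classical in
/-- A representative of the right coset of `g` with respect to the edge group. -/
noncomputable def rep (e : a ⟶ b) (g : 𝒢.vertexGroup b) : 𝒢.vertexGroup b :=
  if g ∈ 𝒢.edgeGroup e then 1
  else (Quotient.mk (QuotientGroup.rightRel (𝒢.edgeGroup e)) g).out

theorem rep_of_mem {e : a ⟶ b} {g : 𝒢.vertexGroup b} (hg : g ∈ 𝒢.edgeGroup e) : rep e g = 1 :=
  if_pos hg

theorem mul_inv_rep_mem (e : a ⟶ b) (g : 𝒢.vertexGroup b) :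
    g * (rep e g)⁻¹ ∈ 𝒢.edgeGroup e := by
  by_cases hg : g ∈ 𝒢.edgeGroup e
  · simpa [rep_of_mem hg]
  · rw [rep, if_neg hg, ← QuotientGroup.rightRel_apply]
    exact Quotient.mk_out (s := QuotientGroup.rightRel (𝒢.edgeGroup e)) g

theorem rep_mul {e : a ⟶ b} {h : 𝒢.vertexGroup b} (hh : h ∈ 𝒢.edgeGroup e)
    (g : 𝒢.vertexGroup b) : rep e (h * g) = rep e g := by
  by_cases hg : g ∈ 𝒢.edgeGroup e
  · rw [rep_of_mem hg, rep_of_mem (mul_mem hh hg)]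
  · rw [rep, rep, if_neg hg, if_neg (by rwa [Subgroup.mul_mem_cancel_left _ hh])]
    congr 1
    refine Quotient.sound (s := QuotientGroup.rightRel (𝒢.edgeGroup e)) ?_
    refine QuotientGroup.rightRel_apply.2 ?_
    simpa using hh

theorem rep_rep (e : a ⟶ b) (g : 𝒢.vertexGroup b) : rep e (rep e g) = rep e g := by
  have := rep_mul (inv_mem (mul_inv_rep_mem e g)) g
  simpa using this

theorem mem_of_rep_eq_one {e : a ⟶ b} {g : 𝒢.vertexGroup b} (h : rep e g = 1) :
    g ∈ 𝒢.edgeGroup e := by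
  simpa [h] using mul_inv_rep_mem e g

end Representatives

/-! ### Normal forms -/

/-- The labels are coset representatives, and there is no backtracking with trivial label. -/
def IsNormal : ∀ {a c : V}, LabelledPath 𝒢.vertexGroup a c → Prop
  | _, _, .nil _ => True
  | a, _, .cons e s p => rep e s = s ∧ (p.firstEdge = some ⟨a, Quiver.reverse e⟩ → s ≠ 1) ∧
      IsNormal p

/-- A normal form `g s_{e₁} t₁ ⋯ s_{eₖ} tₖ`, where `e₁ ⋯ eₖ` is a path from `a` to `c` and the
`tᵢ` are coset representatives. -/
@[ext]
structure NormalForm (𝒢 : GraphOfGroups.{u, v, w} V) (c a : V) where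
  head : 𝒢.vertexGroup a
  path : LabelledPath 𝒢.vertexGroup a c
  isNormal : IsNormal path

namespace NormalForm

variable {a b c : V}

instance : MulAction (𝒢.vertexGroup a) (𝒢.NormalForm c a) where
  smul g n := ⟨g * n.head, n.path, n.isNormal⟩
  one_smul _ := NormalForm.ext (one_mul _) rfl
  mul_smul _ _ _ := NormalForm.ext (mul_assoc _ _ _) rfl

@[simp] theorem head_smul (g : 𝒢.vertexGroup a) (n : 𝒢.NormalForm c a) :
    (g • n).head = g * n.head := rfl

@[simp] theorem path_smul (g : 𝒢.vertexGroup a) (n : 𝒢.NormalForm c a) :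
    (g • n).path = n.path := rfl

/-- Multiplication by `s_e` cancels with the first edge of the normal form. -/
def Cancels (e : a ⟶ b) (n : 𝒢.NormalForm c b) : Prop :=
  n.head ∈ 𝒢.edgeGroup e ∧ ∃ s p, n.path = .cons (Quiver.reverse e) s p

open Classical in
/-- Multiplication of a normal form by `s_e`. -/
noncomputable def cross (e : a ⟶ b) (n : 𝒢.NormalForm c b) : 𝒢.NormalForm c a :=
  if h : n.Cancels e then
    ⟨𝒢.edgeMap e n.head * h.2.choose, h.2.choose_spec.choose, by
      have := n.isNormal
      rw [h.2.choose_spec.choose_spec] at this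
      exact this.2.2⟩
  else
    ⟨𝒢.edgeMap e (n.head * (rep e n.head)⁻¹), .cons e (rep e n.head) n.path,
      rep_rep e _, fun h' h'' => h ⟨mem_of_rep_eq_one h'', LabelledPath.eq_cons_of_firstEdge h'⟩,
      n.isNormal⟩

/-- Computes with any decomposition instead of the chosen one. The edge `f` is kept as a variable
because it is `e` itself, rather than a literal reverse, when `Quiver.reverse e` is crossed. -/
theorem cross_of_cancels {e : a ⟶ b} {n : 𝒢.NormalForm c b} (h : n.head ∈ 𝒢.edgeGroup e)
    {f : b ⟶ a} (hf : f = Quiver.reverse e) {s : 𝒢.vertexGroup a}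
    {p : LabelledPath 𝒢.vertexGroup a c} (hp : n.path = .cons f s p) :
    (cross e n).head = 𝒢.edgeMap e n.head * s ∧ (cross e n).path = p := by
  subst hf
  have h' : n.Cancels e := ⟨h, s, p, hp⟩
  have := h'.2.choose_spec.choose_spec.symm.trans hp
  injection this with h1 h2 h3 h4 h5 h6
  rw [cross, dif_pos h']
  exact ⟨congrArg _ h5, h6⟩

theorem cross_of_not_cancels {e : a ⟶ b} {n : 𝒢.NormalForm c b} (h : ¬ n.Cancels e) :
    (cross e n).head = 𝒢.edgeMap e (n.head * (rep e n.head)⁻¹) ∧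
      (cross e n).path = .cons e (rep e n.head) n.path := by
  rw [cross, dif_neg h]
  exact ⟨rfl, rfl⟩

/-- Crossing back restores a cancelled edge and removes a created one. The first case depends on
normality: a second cancellation would mean that the removed label is 1 in front of a backtracking
edge. -/
theorem cross_reverse_cross (e : a ⟶ b) (n : 𝒢.NormalForm c b) :
    cross (Quiver.reverse e) (cross e n) = n := by
  by_cases h : n.Cancels e
  · obtain ⟨hn, s, p, hp⟩ := h
    have hN := n.isNormal
    rw [hp] at hN
    obtain ⟨h1, h2⟩ := cross_of_cancels hn rfl hp
    have hrep : rep (Quiver.reverse e) (cross e n).head = s := by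
      rw [h1, rep_mul (edgeMap_mem e _), hN.1]
    have h3 : ¬ (cross e n).Cancels (Quiver.reverse e) := by
      rintro ⟨h4, t, q, hq⟩
      rw [rep_of_mem h4] at hrep
      refine hN.2.1 ?_ hrep.symm
      rw [← h2, hq]
      rfl
    obtain ⟨h4, h5⟩ := cross_of_not_cancels h3
    refine NormalForm.ext ?_ ?_
    · rw [h4, hrep, h1, mul_inv_cancel_right, edgeMap_reverse_edgeMap hn]
    · rw [h5, hrep, h2, hp]
  · obtain ⟨h1, h2⟩ := cross_of_not_cancels h
    have h3 : (cross e n).head ∈ 𝒢.edgeGroup (Quiver.reverse e) := by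
      rw [h1]
      exact edgeMap_mem e _
    obtain ⟨h4, h5⟩ := cross_of_cancels h3 (Quiver.reverse_reverse e).symm h2
    refine NormalForm.ext ?_ h5
    rw [h4, h1, edgeMap_reverse_edgeMap (mul_inv_rep_mem e _), inv_mul_cancel_right]

theorem cross_smul {e : a ⟶ b} {h : 𝒢.vertexGroup b} (hh : h ∈ 𝒢.edgeGroup e)
    (n : 𝒢.NormalForm c b) : cross e (h • n) = 𝒢.edgeMap e h • cross e n := by
  by_cases hn : n.Cancels e
  · obtain ⟨hn, s, p, hp⟩ := hn
    obtain ⟨h1, h2⟩ := cross_of_cancels hn rfl hp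
    obtain ⟨h3, h4⟩ := cross_of_cancels (n := h • n) (mul_mem hh hn) rfl hp
    refine NormalForm.ext ?_ (h4.trans h2.symm)
    rw [h3, head_smul, head_smul, edgeMap_mul hh hn, h1, mul_assoc]
  · obtain ⟨h1, h2⟩ := cross_of_not_cancels hn
    have hn' : ¬ (h • n).Cancels e := fun H =>
      hn ⟨(Subgroup.mul_mem_cancel_left _ hh).1 H.1, H.2⟩
    obtain ⟨h3, h4⟩ := cross_of_not_cancels hn'
    refine NormalForm.ext ?_ ?_
    · rw [h3, head_smul, head_smul, rep_mul hh, h1, mul_assoc,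
        edgeMap_mul hh (mul_inv_rep_mem e _)]
    · rw [h4, head_smul, rep_mul hh, path_smul, path_smul, h2]

/-- Multiplication of normal forms by `s_e`, as a bijection. -/
noncomputable def crossEquiv (c : V) (e : a ⟶ b) : 𝒢.NormalForm c b ≃ 𝒢.NormalForm c a where
  toFun := cross e
  invFun := cross (Quiver.reverse e)
  left_inv := cross_reverse_cross e
  right_inv n := by simpa using cross_reverse_cross (Quiver.reverse e) n

end NormalForm

open NormalForm in
-- The potential `γ` turns the groupoid-like action on all the sets of normal forms ending at `c`
-- into an action on one set in which tree edges act trivially. The other two kinds of relators are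
-- `cross_reverse_cross` and `cross_smul`.
theorem exists_representation (hT : IsMaximalTree T) (c : V) :
    ∃ (P : Type (max u v w)) (γ : ∀ a, 𝒢.NormalForm c a ≃ P)
      (ρ : 𝒢.FundamentalGroup T →* Equiv.Perm P),
      (∀ a g n, ρ (𝒢.ofVertex T a g) (γ a n) = γ a (g • n)) ∧
      ∀ {a b : V} (e : a ⟶ b) (n : 𝒢.NormalForm c b),
        ρ (𝒢.stable T e) (γ b n) = γ a (cross e n) := by
  obtain ⟨γ, hγ⟩ := hT.exists_potential (Ω := 𝒢.NormalForm c) (fun e => crossEquiv c e)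
    (fun e => Equiv.ext fun n => rfl) c
  let f : 𝒢.FreeProd →* Equiv.Perm (𝒢.NormalForm c c) := Monoid.Coprod.lift
    (Monoid.CoprodI.lift fun a => (γ a).permCongrHom.toMonoidHom.comp
      (MulAction.toPermHom (𝒢.vertexGroup a) (𝒢.NormalForm c a)))
    (FreeGroup.lift fun e => (γ e.right).symm.trans ((crossEquiv c e.hom).trans (γ e.left)))
  have hf1 : ∀ a g n, f (𝒢.preVertex a g) (γ a n) = γ a (g • n) := by
    intro a g n
    simp [f, preVertex]
  have hf2 : ∀ {a b : V} (e : a ⟶ b) (n : 𝒢.NormalForm c b),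
      f (𝒢.preStable e) (γ b n) = γ a (cross e n) := by
    intro a b e n
    simp [f, preStable]
    rfl
  have hker : ∀ x ∈ Subgroup.normalClosure {r | Relator 𝒢 T r}, f x = 1 := by
    have : Subgroup.normalClosure {r | Relator 𝒢 T r} ≤ f.ker := by
      refine Subgroup.normalClosure_le_normal ?_
      rintro r hr
      rw [SetLike.mem_coe, MonoidHom.mem_ker]
      cases hr with
      | @inv a b e =>
        ext m : 1
        obtain ⟨n, rfl⟩ := (γ b).surjective m
        rw [map_mul, Equiv.Perm.mul_apply, hf2, hf2, cross_reverse_cross]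
        rfl
      | @tree a b e he =>
        ext m : 1
        obtain ⟨n, rfl⟩ := (γ b).surjective m
        rw [hf2, hγ e he]
        rfl
      | @conj a b e g =>
        rw [map_mul, map_mul, map_mul, map_inv, map_inv, mul_inv_eq_one, mul_inv_eq_iff_eq_mul]
        ext m : 1
        obtain ⟨n, rfl⟩ := (γ b).surjective m
        rw [Equiv.Perm.mul_apply, Equiv.Perm.mul_apply, hf1, hf2, hf2, hf1, cross_smul g.2,
          edgeMap_of_mem g.2]
    exact fun x hx => this hx
  exact ⟨_, γ, QuotientGroup.lift _ f hker, fun a g n => hf1 a g n, fun e n => hf2 e n⟩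

/-! ### Uniqueness of reduced paths -/

variable {X : ∀ a, Finset (𝒢.vertexGroup a)}
  {L : ∀ {a b : V}, (a ⟶ b) → Language (X b × Bool)}

namespace WordPath

/-- Multiplication of a normal form by the value of a path. -/
noncomputable def act {d : V} :
    ∀ {a c : V}, WordPath 𝒢 X a c → 𝒢.NormalForm d c → 𝒢.NormalForm d a
  | _, _, .nil _, n => n
  | _, _, .cons e s p, n => (evalWord (𝒢.gens X _) s • act p n).cross e

/-- Reading a reduced path from its end never triggers a cancellation. The statement about the head
drives the induction: the head produced by the first edge of `p` lies in the edge group, so it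
cannot bring the label `s` into that group. -/
theorem IsReduced.act_spec {a c : V} {p : WordPath 𝒢 X a c} (hp : p.IsReduced L)
    (x : 𝒢.vertexGroup c) :
    (act p ⟨x, .nil c, trivial⟩).path.firstEdge = p.firstEdge ∧
      (act p ⟨x, .nil c, trivial⟩).path.length = p.length ∧
      ∀ b (e : a ⟶ b), p.firstEdge = some ⟨b, e⟩ →
        (act p ⟨x, .nil c, trivial⟩).head ∈ 𝒢.edgeGroup (Quiver.reverse e) := by
  induction p with
  | nil c => exact ⟨rfl, rfl, by simp⟩
  | @cons a b c e s p ih =>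
    obtain ⟨-, hs, hp⟩ := hp
    obtain ⟨h1, h2, h3⟩ := ih hp x
    have hn : ¬ (evalWord (𝒢.gens X _) s • act p ⟨x, .nil c, trivial⟩).Cancels e := by
      rintro ⟨H1, t, q, H2⟩
      rw [NormalForm.path_smul] at H2
      rw [H2, LabelledPath.firstEdge_cons] at h1
      refine hs h1.symm ?_
      have := h3 _ _ h1.symm
      rw [Quiver.reverse_reverse] at this
      rwa [NormalForm.head_smul, Subgroup.mul_mem_cancel_right _ this] at H1
    obtain ⟨h4, h5⟩ := NormalForm.cross_of_not_cancels hn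
    rw [WordPath.act, h4, h5]
    refine ⟨rfl, ?_, ?_⟩
    · simp only [LabelledPath.length, NormalForm.path_smul, h2]
    · rintro b e ⟨⟩
      exact edgeMap_mem e _

/-- Both sides act equally on the trivial normal form at `c`, so the resulting heads and paths
agree. -/
theorem eq_of_value_eq (hT : IsMaximalTree T) {a c : V} {p q : WordPath 𝒢 X a c}
    (hp : p.IsReduced L) (hq : q.IsReduced L) {g h : 𝒢.vertexGroup a} {x y : 𝒢.vertexGroup c}
    (H : 𝒢.ofVertex T a g * p.value T * 𝒢.ofVertex T c x =
      𝒢.ofVertex T a h * q.value T * 𝒢.ofVertex T c y) :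
    p.firstEdge = q.firstEdge ∧ p.length = q.length ∧
      ∀ b (e : a ⟶ b), p.firstEdge = some ⟨b, e⟩ →
        g⁻¹ * h ∈ 𝒢.edgeGroup (Quiver.reverse e) := by
  obtain ⟨P, γ, ρ, h1, h2⟩ := exists_representation (𝒢 := 𝒢) hT c
  have hact : ∀ {a d : V} (p : WordPath 𝒢 X a d) n, ρ (p.value T) (γ d n) = γ a (p.act n) := by
    intro a d p
    induction p with
    | nil a =>
      intro n
      rw [value, map_one]
      rfl
    | cons e s p ih =>
      intro n
      rw [value, map_mul, map_mul, Equiv.Perm.mul_apply, Equiv.Perm.mul_apply, ih, h1, h2]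
      rfl
  have key : ∀ (p : WordPath 𝒢 X a c) (g : 𝒢.vertexGroup a) (x : 𝒢.vertexGroup c),
      ρ (𝒢.ofVertex T a g * p.value T * 𝒢.ofVertex T c x) (γ c ⟨1, .nil c, trivial⟩) =
        γ a (g • p.act ⟨x, .nil c, trivial⟩) := by
    intro p g x
    rw [map_mul, map_mul, Equiv.Perm.mul_apply, Equiv.Perm.mul_apply, h1, hact, h1]
    congr 3
    exact NormalForm.ext (mul_one x) rfl
  have e := (γ a).injective ((key p g x).symm.trans (H ▸ key q h y))
  obtain ⟨p1, p2, p3⟩ := hp.act_spec x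
  obtain ⟨q1, q2, q3⟩ := hq.act_spec y
  have epath := congrArg NormalForm.path e
  have ehead := congrArg NormalForm.head e
  simp only [NormalForm.path_smul, NormalForm.head_smul] at epath ehead
  have hfirst : p.firstEdge = q.firstEdge := by rw [← p1, ← q1, epath]
  refine ⟨hfirst, by rw [← p2, ← q2, epath], fun b f hf => ?_⟩
  have e3 : g⁻¹ * h = (p.act ⟨x, .nil c, trivial⟩).head *
      (q.act ⟨y, .nil c, trivial⟩).head⁻¹ := by
    rw [eq_mul_inv_iff_mul_eq, mul_assoc, ← ehead, inv_mul_cancel_left]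
  rw [e3]
  exact mul_mem (p3 b f hf) (inv_mem (q3 b f (hfirst ▸ hf)))

end WordPath

theorem ofVertex_injective (hT : IsMaximalTree T) (a : V) :
    Function.Injective (𝒢.ofVertex T a) := by
  obtain ⟨P, γ, ρ, h1, -⟩ := exists_representation (𝒢 := 𝒢) hT a
  intro g h hgh
  have := (h1 a g ⟨1, .nil a, trivial⟩).symm.trans (hgh ▸ h1 a h ⟨1, .nil a, trivial⟩)
  simpa using congrArg NormalForm.head ((γ a).injective this)

end GraphOfGroups

namespace GraphOfGroups

variable {V : Type u} [Quiver.{v} V] [Quiver.HasInvolutiveReverse V]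
  {𝒢 : GraphOfGroups.{u, v, w} V} {T : WideSubquiver V}
  {X : ∀ a, Finset (𝒢.vertexGroup a)}
  {L : ∀ {a b : V}, (a ⟶ b) → Language (X b × Bool)}

/-! ### Extension of paths -/

section Extension

theorem edgeLetter_of_mem {a b : V} {e : a ⟶ b} (he : e ∈ T a b) :
    edgeLetter X T ⟨a, b, e⟩ = none :=
  dif_neg (not_not.2 he)

theorem range_gens (a : V) : Set.range (𝒢.gens X a) = (X a : Set (𝒢.vertexGroup a)) :=
  Subtype.range_coe

namespace WordPath

theorem word_comp {a b c : V} (p : WordPath 𝒢 X a b) (q : WordPath 𝒢 X b c) :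
    word T (p.comp q) = word T p ++ word T q := by
  induction p with
  | nil => rfl
  | cons e s p ih => simp only [LabelledPath.comp, word, ih, List.append_assoc]

theorem value_comp {a b c : V} (p : WordPath 𝒢 X a b) (q : WordPath 𝒢 X b c) :
    value T (p.comp q) = value T p * value T q := by
  rw [← evalWord_word, word_comp, evalWord_append, evalWord_word, evalWord_word]

/-- Empty labels lie in every edge group, so reducedness comes entirely from the tree path being
simple; tree letters are omitted, so nothing is spelled. -/
theorem exists_treePath (hT : IsMaximalTree T) (hnil : ∀ {a b : V} (e : a ⟶ b), [] ∈ L e)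
    (a c : V) : ∃ p : WordPath 𝒢 X a c, word T p = [] ∧ IsReduced L p ∧
      ∀ b (e : a ⟶ b), p.firstEdge = some ⟨b, e⟩ → e ∈ T a b := by
  -- Knowing that the first edge leads to a vertex of `W` excludes backtracking when an edge is put
  -- in front.
  have key : ∀ {a c : V} (W : (spannedGraph T).Walk a c), W.IsPath →
      ∃ p : WordPath 𝒢 X a c, word T p = [] ∧ IsReduced L p ∧
        ∀ b (e : a ⟶ b), p.firstEdge = some ⟨b, e⟩ → e ∈ T a b ∧ b ∈ W.support := by
    intro a c W
    induction W with
    | nil => exact fun _ => ⟨.nil _, rfl, trivial, by simp⟩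
    | @cons a b c h W ih =>
      intro hW
      rw [SimpleGraph.Walk.cons_isPath_iff] at hW
      obtain ⟨p, h1, h2, h3⟩ := ih hW.1
      obtain ⟨e, he⟩ := hT.nonempty_of_adj h
      refine ⟨.cons e [] p, ?_, ⟨hnil e, fun H => absurd (h3 _ _ H).2 hW.2, h2⟩, ?_⟩
      · simp [word, edgeLetter_of_mem he, h1, vertexWord]
      · rintro b e ⟨⟩
        exact ⟨he, by simp⟩
  obtain ⟨W, hW⟩ := (hT.isTree.connected.preconnected a c).exists_isPath
  obtain ⟨p, h1, h2, h3⟩ := key W hW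
  exact ⟨p, h1, h2, fun b e h => (h3 b e h).1⟩

theorem IsReduced.comp_of_isFinal (hT : IsMaximalTree T) {a b c : V} {p : WordPath 𝒢 X a b}
    {q : WordPath 𝒢 X b c} (hp : p.IsReduced L) (hp' : p.IsFinal T) (hq : q.IsReduced L)
    (hq' : ∀ d (e : b ⟶ d), q.firstEdge = some ⟨d, e⟩ → e ∈ T b d) :
    IsReduced L (p.comp q) := by
  induction p with
  | nil => exact hq
  | @cons a b d e s p ih =>
    refine ⟨hp.1, ?_, ih hp.2.2 hp'.2 hq hq'⟩
    cases p with
    | nil =>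
      intro h
      have := hT.reverse_mem _ (hq' _ _ h)
      rw [Quiver.reverse_reverse] at this
      exact hp'.1 rfl this
    | cons f t p => exact hp.2.1

/-- Paths can be compared only when they end at the same vertex. `IsFinal` is exactly what prevents
cancellation where the tree path is attached. -/
theorem exists_extension (hT : IsMaximalTree T) (hnil : ∀ {a b : V} (e : a ⟶ b), [] ∈ L e)
    {a c : V} {p : WordPath 𝒢 X a c} (hp : p.IsReduced L) (hp' : p.IsFinal T) (d : V) :
    ∃ q : WordPath 𝒢 X a d, IsReduced L q ∧ word T q = word T p := by
  obtain ⟨r, h1, h2, h3⟩ := exists_treePath hT hnil c d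
  exact ⟨p.comp r, hp.comp_of_isFinal hT hp' h2 h3, by rw [word_comp, h1, List.append_nil]⟩

theorem IsReduced.comp_edge (hnil : ∀ {a b : V} (e : a ⟶ b), [] ∈ L e) {a b c : V}
    {p : WordPath 𝒢 X a b} (hp : p.IsReduced L) (f : b ⟶ c) :
    IsReduced L (p.comp (.cons f [] (.nil c))) ∨
      ∃ (p₁ : WordPath 𝒢 X a c) (s : List (X b × Bool)),
        p = p₁.comp (.cons (Quiver.reverse f) s (.nil b)) ∧
        evalWord (𝒢.gens X b) s ∈ 𝒢.edgeGroup (Quiver.reverse f) ∧ IsReduced L p₁ := by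
  induction p with
  | nil b => exact Or.inl ⟨hnil f, by simp, trivial⟩
  | @cons a b d e s p ih =>
    rcases ih hp.2.2 f with h | ⟨p₁, t, rfl, h1, h2⟩
    · cases p with
      | nil b =>
        by_cases H : (⟨c, f⟩ : Σ c, b ⟶ c) = ⟨a, Quiver.reverse e⟩ ∧
          evalWord (𝒢.gens X b) s ∈ 𝒢.edgeGroup e
        · obtain ⟨H1, H2⟩ := H
          cases H1
          rw [Quiver.reverse_reverse]
          exact Or.inr ⟨.nil _, s, rfl, H2, trivial⟩
        · exact Or.inl ⟨hp.1, fun h1 h2 => H ⟨Option.some_injective _ h1, h2⟩, h⟩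
      | cons g t p => exact Or.inl ⟨hp.1, hp.2.1, h⟩
    · refine Or.inr ⟨.cons e s p₁, t, rfl, h1, hp.1, ?_, h2⟩
      cases p₁ with
      | nil => simp
      | cons g t p => exact hp.2.1

end WordPath

end Extension

/-! ### Fellow travelling -/

section FellowTravel

variable {Y : ∀ {a b : V}, (a ⟶ b) → Finset (𝒢.vertexGroup b)}

/-- Constants that work for all the edges at the same time. -/
structure UniformConstants (X : ∀ a, Finset (𝒢.vertexGroup a))
    (L : ∀ {a b : V}, (a ⟶ b) → Language (X b × Bool))
    (Y : ∀ {a b : V}, (a ⟶ b) → Finset (𝒢.vertexGroup b)) (N M : ℕ) : Prop where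
  crossover : ∀ {a a' b : V} (e : a ⟶ b) (f : a' ⟶ b), HasLimitedCrossoverWith N (𝒢.gens X b) (L e)
    (Y e : Set (𝒢.vertexGroup b)) (Y f : Set (𝒢.vertexGroup b))
  stable : ∀ {a b : V} (e : a ⟶ b), ∀ h ∈ 𝒢.edgeGroup e,
    WordLengthLE (Y e : Set (𝒢.vertexGroup b)) N h →
    WordLengthLE (Y (Quiver.reverse e) : Set (𝒢.vertexGroup a)) N (𝒢.edgeMap e h)
  wordLengthLE : ∀ {a b : V} (e : a ⟶ b), ∀ s ∈ L e, ∀ t ∈ L e, ∀ h ∈ 𝒢.edgeGroup e,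
    CayleyDistLE (𝒢.gens X b) 1 (evalWord (𝒢.gens X b) s) (h * evalWord (𝒢.gens X b) t) →
    WordLengthLE (Y e : Set (𝒢.vertexGroup b)) N h
  dist : ∀ {a b : V} (e : a ⟶ b) (h : 𝒢.vertexGroup b),
    WordLengthLE (Y e : Set (𝒢.vertexGroup b)) N h → WordLengthLE (Set.range (𝒢.gens X b)) M h
  interleaved : ∀ {a b : V} (e : a ⟶ b), ∀ s ∈ L e, ∀ t ∈ L e, ∀ h ∈ 𝒢.edgeGroup e,
    (CayleyDistLE (𝒢.gens X b) 1 (evalWord (𝒢.gens X b) s) (h * evalWord (𝒢.gens X b) t) ∨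
      ∃ (a' : V) (f : a' ⟶ b), WordLengthLE (Y f : Set (𝒢.vertexGroup b)) N
        ((evalWord (𝒢.gens X b) s)⁻¹ * (h * evalWord (𝒢.gens X b) t))) →
    Interleaved (𝒢.gens X b) M 1 h s t

theorem exists_forall_dvd {I : Type*} [Finite I] {f : I → ℕ} (hf : ∀ i, 1 ≤ f i) :
    ∃ n, n ≠ 0 ∧ ∀ i, f i ∣ n := by
  have := Fintype.ofFinite I
  exact ⟨∏ i, f i, Finset.prod_ne_zero_iff.2 fun i _ => Nat.one_le_iff_ne_zero.1 (hf i),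
    fun i => Finset.dvd_prod_of_mem f (Finset.mem_univ i)⟩

theorem exists_forall_le {I : Type*} [Finite I] (f : I → ℕ) : ∃ n, ∀ i, f i ≤ n := by
  obtain ⟨n, hn⟩ := (Set.finite_range f).bddAbove
  exact ⟨n, fun i => hn ⟨i, rfl⟩⟩

/-- Crossover and stability hold with any nonzero common multiple of the individual constants, which
can also be taken large enough for the elements `h` at the end of a path. -/
theorem exists_uniformConstants [Finite V] [∀ a b : V, Finite (a ⟶ b)]
    (hX : ∀ a, Subgroup.closure (X a : Set (𝒢.vertexGroup a)) = ⊤)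
    (hY : ∀ {a b : V} (e : a ⟶ b),
      Subgroup.closure (Y e : Set (𝒢.vertexGroup b)) = 𝒢.edgeGroup e)
    (hL : ∀ {a b : V} (e : a ⟶ b),
      IsStronglyAsyncCosetAutomatic (𝒢.gens X b) (𝒢.edgeGroup e) (L e))
    (hstable : ∀ {a b : V} (e : a ⟶ b), IsStableIso (𝒢.φ e) (Y e : Set (𝒢.vertexGroup b))
      (Y (Quiver.reverse e) : Set (𝒢.vertexGroup a)))
    (hcross : ∀ {a a' b : V} (e : a ⟶ b) (f : a' ⟶ b), HasLimitedCrossover (𝒢.gens X b) (L e)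
      (Y e : Set (𝒢.vertexGroup b)) (Y f : Set (𝒢.vertexGroup b))) :
    ∃ N M, UniformConstants X (fun e => L e) (fun e => Y e) N M := by
  have hfin := finite_total V
  have hball : ∀ e : Quiver.Total V, ∃ n, ∀ s ∈ L e.hom, ∀ t ∈ L e.hom, ∀ h ∈ 𝒢.edgeGroup e.hom,
      CayleyDistLE (𝒢.gens X e.right) 1 (evalWord (𝒢.gens X e.right) s)
        (h * evalWord (𝒢.gens X e.right) t) →
      WordLengthLE (Y e.hom : Set (𝒢.vertexGroup e.right)) n h := by
    intro e
    obtain ⟨K, hK⟩ := (hL e.hom).exists_interleaved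
    obtain ⟨n, hn⟩ := exists_forall_wordLengthLE
      (S := (Y e.hom : Set (𝒢.vertexGroup e.right)))
      (((finite_setOf_wordLengthLE (Set.finite_range (𝒢.gens X e.right)) K)).inter_of_left
        (𝒢.edgeGroup e.hom : Set (𝒢.vertexGroup e.right))) (fun g hg => by
          rw [hY]
          exact hg.2)
    refine ⟨n, fun s hs t ht h hh hd => hn h ⟨?_, hh⟩⟩
    simpa [CayleyDistLE] using (hK s hs t ht h hh hd).dist
  choose n hn using hball
  obtain ⟨B, hB⟩ := exists_forall_le n
  choose l hl1 hl2 using fun i : Σ b : V, (Σ a, a ⟶ b) × (Σ a, a ⟶ b) => hcross i.2.1.2 i.2.2.2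
  choose m hm1 hm2 using fun e : Quiver.Total V => hstable e.hom
  obtain ⟨l', hl'0, hl'⟩ := exists_forall_dvd hl1
  obtain ⟨m', hm'0, hm'⟩ := exists_forall_dvd hm1
  -- A multiple of all crossover and stability constants that is at least `B`.
  obtain ⟨N, hN⟩ : ∃ N, N = (B + 1) * (m' * l') := ⟨_, rfl⟩
  have hN0 : N ≠ 0 := by
    rw [hN]
    exact mul_ne_zero B.succ_ne_zero (mul_ne_zero hm'0 hl'0)
  have hNB : B ≤ N := by
    rw [hN]
    exact B.le_succ.trans (Nat.le_mul_of_pos_right _ (Nat.pos_of_ne_zero (mul_ne_zero hm'0 hl'0)))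
  have hdist : ∀ e : Quiver.Total V, ∃ R, ∀ h, WordLengthLE (Y e.hom : Set _) N h →
      WordLengthLE (Set.range (𝒢.gens X e.right)) R h := fun e =>
    exists_forall_wordLengthLE
      (finite_setOf_wordLengthLE (Y e.hom).finite_toSet N) fun g _ => by
        rw [range_gens, hX]
        trivial
  choose R hR using hdist
  obtain ⟨R', hR'⟩ := exists_forall_le R
  -- Distance `R' + 1` covers both alternatives in `interleaved`: a single letter, and an element of
  -- edge group length at most `N`.
  choose K hK using fun e : Quiver.Total V => (hL e.hom).exists_interleaved_of_dist (R' + 1)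
  obtain ⟨K', hK'⟩ := exists_forall_le K
  refine ⟨N, R' + K', ?_, ?_, ?_, ?_, ?_⟩
  · intro a a' b e f
    have hdvd : l ⟨b, ⟨a, e⟩, ⟨a', f⟩⟩ ∣ N := by
      rw [hN]
      exact ((hl' _).mul_left _).mul_left _
    obtain ⟨k, hk⟩ := hdvd
    have := (hl2 ⟨b, ⟨a, e⟩, ⟨a', f⟩⟩).mul (by rw [hY]; exact (hL e).isCosetLanguage) k (by
      rintro rfl
      exact hN0 (by simpa using hk))
    rwa [mul_comm, ← hk] at this
  · intro a b e h hh hlen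
    have hdvd : m ⟨a, b, e⟩ ∣ N := by
      rw [hN]
      exact ((hm' _).mul_right _).mul_left _
    obtain ⟨k, hk⟩ := hdvd
    rw [hk, mul_comm] at hlen ⊢
    rw [edgeMap_of_mem hh]
    exact wordLengthLE_mul_of_stable (hY e) (hm2 ⟨a, b, e⟩) k ⟨h, hh⟩ hlen
  · intro a b e s hs t ht h hh hd
    exact (hn ⟨a, b, e⟩ s hs t ht h hh hd).mono ((hB _).trans hNB)
  · intro a b e h hh
    exact (hR ⟨a, b, e⟩ h hh).mono ((hR' _).trans (Nat.le_add_right _ _))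
  · intro a b e s hs t ht h hh hd
    refine (hK ⟨a, b, e⟩ s hs t ht h hh ?_).mono ((hK' _).trans (Nat.le_add_left _ _))
    rcases hd with hd | ⟨a', f, hd⟩
    · exact hd.mono (Nat.le_add_left _ _)
    · exact (hR ⟨a', b, f⟩ _ hd).mono ((hR' _).trans (Nat.le_add_right _ _))

/-- The length bound on `h` is part of the claim because it travels from right to left: the tail
yields the bound on `k`, stability the one on `g = φ(k)`, crossover the one on `h`. The extra 1 in
`M + 1` comes from the letters `s_e`. -/
theorem UniformConstants.interleaved_path (hT : IsMaximalTree T)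
    (hY : ∀ {a b : V} (e : a ⟶ b),
      Subgroup.closure (Y e : Set (𝒢.vertexGroup b)) = 𝒢.edgeGroup e) {N M : ℕ}
    (hc : UniformConstants X (fun e => L e) (fun e => Y e) N M)
    {a c : V} {p q : WordPath 𝒢 X a c} (hp : p.IsReduced L) (hq : q.IsReduced L)
    {a' : V} {f : a' ⟶ a} {s t : List (X a × Bool)} (hs : s ∈ L f) (ht : t ∈ L f)
    {h : 𝒢.vertexGroup a} (hh : h ∈ 𝒢.edgeGroup f) {x : 𝒢.vertexGroup c}
    (hx : WordLengthLE (Set.range (𝒢.gens X c)) 1 x)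
    (H : 𝒢.ofVertex T a (evalWord (𝒢.gens X a) s) * p.value T * 𝒢.ofVertex T c x =
      𝒢.ofVertex T a (h * evalWord (𝒢.gens X a) t) * q.value T) :
    WordLengthLE (Y f : Set (𝒢.vertexGroup a)) N h ∧
      Interleaved (𝒢.genMap X T) (M + 1) 1 (𝒢.ofVertex T a h)
        (vertexWord X T a s ++ p.word T) (vertexWord X T a t ++ q.word T) := by
  have push : ∀ {a : V} {h : 𝒢.vertexGroup a} {s t : List (X a × Bool)},
      Interleaved (𝒢.gens X a) M 1 h s t →
      Interleaved (𝒢.genMap X T) (M + 1) 1 (𝒢.ofVertex T a h) (vertexWord X T a s)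
        (vertexWord X T a t) := by
    intro a h s t H
    have := (H.translate_map (x' := 𝒢.genMap X T) (j := fun y => Sum.inl ⟨a, y⟩)
      (𝒢.ofVertex T a) (fun _ => rfl) 1).mono
      M.le_succ
    simp only [map_one, one_mul] at this
    exact this
  have hdist : ∀ {a b : V} (e : a ⟶ b) (h : 𝒢.vertexGroup b),
      WordLengthLE (Y e : Set (𝒢.vertexGroup b)) N h →
      WordLengthLE (Set.range (𝒢.genMap X T)) M (𝒢.ofVertex T b h) := by
    intro a b e h hh
    refine (hc.dist e h hh).map _ ?_
    rintro _ ⟨y, rfl⟩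
    exact ⟨Sum.inl ⟨b, y⟩, rfl⟩
  induction p generalizing a' with
  | nil c =>
    obtain ⟨h1, -, -⟩ := WordPath.eq_of_value_eq hT hp hq
      (g := evalWord (𝒢.gens X _) s)
      (h := h * evalWord (𝒢.gens X _) t) (x := x) (y := 1) (by rw [map_one, mul_one, H])
    cases q with
    | cons => cases h1
    | nil =>
      rw [WordPath.value, mul_one, mul_one, ← map_mul] at H
      have H' := ofVertex_injective hT _ H
      have hd : CayleyDistLE (𝒢.gens X c) 1 (evalWord (𝒢.gens X c) s)
          (h * evalWord (𝒢.gens X c) t) := by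
        rw [← H', CayleyDistLE, inv_mul_cancel_left]
        exact hx
      refine ⟨hc.wordLengthLE f s hs t ht h hh hd, ?_⟩
      simpa [WordPath.word] using push (hc.interleaved f s hs t ht h hh (Or.inl hd))
  | @cons a b c e u p ih =>
    obtain ⟨h1, -, h3⟩ := WordPath.eq_of_value_eq hT hp hq
      (g := evalWord (𝒢.gens X _) s)
      (h := h * evalWord (𝒢.gens X _) t) (x := x) (y := 1) (by rw [map_one, mul_one, H])
    obtain ⟨u', q, rfl⟩ := LabelledPath.eq_cons_of_firstEdge h1.symm
    obtain ⟨g, hg⟩ : ∃ g, g = (evalWord (𝒢.gens X a) s)⁻¹ * (h * evalWord (𝒢.gens X a) t) :=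
      ⟨_, rfl⟩
    -- The normal form theorem puts the discrepancy `g` in front of the common edge `e` into the
    -- edge group, so it moves across `s_e` and becomes `k`.
    have hgmem : g ∈ 𝒢.edgeGroup (Quiver.reverse e) := hg ▸ h3 b e rfl
    obtain ⟨k, hk⟩ : ∃ k, k = 𝒢.edgeMap (Quiver.reverse e) g := ⟨_, rfl⟩
    have hkmem : k ∈ 𝒢.edgeGroup e := hk ▸ edgeMap_reverse_mem e g
    have hkg : 𝒢.edgeMap e k = g := by rw [hk, edgeMap_edgeMap_reverse hgmem]
    have hst : h * evalWord (𝒢.gens X a) t = evalWord (𝒢.gens X a) s * g := by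
      rw [hg, mul_inv_cancel_left]
    have hmove : 𝒢.ofVertex T a g * 𝒢.stable T e = 𝒢.stable T e * 𝒢.ofVertex T b k := by
      rw [stable_mul_ofVertex T hkmem, hkg]
    have H' : 𝒢.ofVertex T b (evalWord (𝒢.gens X b) u) * WordPath.value T p * 𝒢.ofVertex T c x =
        𝒢.ofVertex T b (k * evalWord (𝒢.gens X b) u') * WordPath.value T q := by
      rw [hst, WordPath.value, WordPath.value, map_mul] at H
      simp only [← mul_assoc] at H
      rw [mul_assoc _ (𝒢.ofVertex T a g), hmove] at H
      simp only [mul_assoc, mul_right_inj] at H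
      rw [map_mul, mul_assoc, mul_assoc, H]
    obtain ⟨hlen, hint⟩ := ih hp.2.2 hq.2.2 hp.1 hq.1 hkmem hx H'
    have hglen : WordLengthLE (Y (Quiver.reverse e) : Set (𝒢.vertexGroup a)) N g :=
      hkg ▸ hc.stable e k hkmem hlen
    have hsg : evalWord (𝒢.gens X a) s * g * (evalWord (𝒢.gens X a) t)⁻¹ = h := by
      rw [← hst, mul_inv_cancel_right]
    refine ⟨?_, ?_⟩
    · have := hc.crossover f (Quiver.reverse e) g hglen s hs t ht
      rw [hsg, hY] at this
      exact this hh
    · have i1 := push (hc.interleaved f s hs t ht h hh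
        (Or.inr ⟨_, Quiver.reverse e, hg ▸ hglen⟩))
      have e1 : 𝒢.ofVertex T a h * 𝒢.ofVertex T a (evalWord (𝒢.gens X a) t) =
          𝒢.ofVertex T a (evalWord (𝒢.gens X a) s) * 𝒢.ofVertex T a g := by
        rw [← map_mul, ← map_mul, hst]
      rw [WordPath.word, WordPath.word, List.append_assoc, List.append_assoc]
      refine i1.append ?_
      rw [evalWord_vertexWord, evalWord_vertexWord, one_mul, e1]
      have e2 : 𝒢.ofVertex T a (evalWord (𝒢.gens X a) s) * 𝒢.ofVertex T a g * 𝒢.stable T e =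
          𝒢.ofVertex T a (evalWord (𝒢.gens X a) s) * 𝒢.stable T e * 𝒢.ofVertex T b k := by
        rw [mul_assoc, hmove, mul_assoc]
      refine Interleaved.append (Interleaved.option _ ?_ ?_) ?_
      · simpa [CayleyDistLE] using hdist _ g hglen
      · rw [evalWord_edgeLetter, e2]
        rw [CayleyDistLE, inv_mul_cancel_left]
        exact hdist _ k hlen
      · rw [evalWord_edgeLetter, e2]
        simpa using hint.translate (𝒢.ofVertex T a (evalWord (𝒢.gens X a) s) * 𝒢.stable T e)

end FellowTravel

/-! ### Existence of coset representatives -/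

section Representatives

/-- The elements `g₀ s_{e₁} u₁ ⋯ s_{eₖ} uₖ` such that `e₁ ⋯ eₖ` is a path that starts at `a`, and
satisfies the conditions of the Higgins coset language. -/
def higginsElements (T : WideSubquiver V)
    (L : ∀ {a b : V}, (a ⟶ b) → Language (X b × Bool)) (a : V) : Set (𝒢.FundamentalGroup T) :=
  {g | ∃ (g₀ : 𝒢.vertexGroup a) (c : V) (p : WordPath 𝒢 X a c), p.IsReduced L ∧ p.IsFinal T ∧
    g = 𝒢.ofVertex T a g₀ * p.value T}

theorem ofVertex_mul_mem_higginsElements {a : V} (h : 𝒢.vertexGroup a)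
    {g : 𝒢.FundamentalGroup T} (hg : g ∈ higginsElements T (fun e => L e) a) :
    𝒢.ofVertex T a h * g ∈ higginsElements T (fun e => L e) a := by
  obtain ⟨g₀, c, p, h1, h2, rfl⟩ := hg
  exact ⟨h * g₀, c, p, h1, h2, by rw [map_mul, mul_assoc]⟩

/-- Replace `g₀` by its coset representative, moving the edge group factor to the left of `s_e`. The
new syllable is then put in front unless it is forbidden: a backtracking pair cancels, and a last
tree edge with label in the edge group is dropped because `s_e = 1`. -/
theorem stable_mul_mem_higginsElements
    (hL : ∀ {a b : V} (e : a ⟶ b), IsCosetLanguage (𝒢.gens X b) (𝒢.edgeGroup e) (L e))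
    {a b : V} (e : a ⟶ b)
    {g : 𝒢.FundamentalGroup T} (hg : g ∈ higginsElements T (fun e => L e) b) :
    𝒢.stable T e * g ∈ higginsElements T (fun e => L e) a := by
  obtain ⟨g₀, c, p, h1, h2, rfl⟩ := hg
  obtain ⟨s, hs, h, hh, e1⟩ := hL e g₀
  have e2 : g₀ = h⁻¹ * evalWord (𝒢.gens X b) s := by rw [e1, inv_mul_cancel_left]
  have e3 : 𝒢.stable T e * (𝒢.ofVertex T b g₀ * p.value T) = 𝒢.ofVertex T a (𝒢.edgeMap e h⁻¹) *
      (𝒢.stable T e * 𝒢.ofVertex T b (evalWord (𝒢.gens X b) s) * p.value T) := by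
    rw [e2, map_mul]
    simp only [← mul_assoc]
    rw [stable_mul_ofVertex T (inv_mem hh)]
  rw [e3]
  refine ofVertex_mul_mem_higginsElements _ ?_
  by_cases h3 : p.firstEdge = some ⟨a, Quiver.reverse e⟩ ∧
      evalWord (𝒢.gens X b) s ∈ 𝒢.edgeGroup e
  · obtain ⟨hf, hm⟩ := h3
    obtain ⟨t, q, rfl⟩ := LabelledPath.eq_cons_of_firstEdge hf
    rw [stable_mul_ofVertex T hm, mul_assoc]
    refine ofVertex_mul_mem_higginsElements _ ⟨evalWord (𝒢.gens X a) t, c, q, h1.2.2, h2.2, ?_⟩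
    rw [WordPath.value, stable_reverse]
    simp only [mul_assoc, mul_inv_cancel_left]
  by_cases h4 : p.firstEdge = none ∧ e ∈ T a b ∧ evalWord (𝒢.gens X b) s ∈ 𝒢.edgeGroup e
  · obtain ⟨hf, he, hm⟩ := h4
    rw [stable_mul_ofVertex T hm, mul_assoc]
    refine ofVertex_mul_mem_higginsElements _ ?_
    cases p with
    | nil => exact ⟨1, a, .nil a, trivial, trivial, by
        rw [stable_of_mem T he, map_one, WordPath.value, WordPath.value]⟩
    | cons => cases hf
  · exact ⟨1, c, .cons e s p, ⟨hs, fun h h' => h3 ⟨h, h'⟩, h1⟩,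
      ⟨fun h h' h'' => h4 ⟨h, h', h''⟩, h2⟩, by rw [map_one, one_mul, WordPath.value]⟩

/-- For a tree edge, multiplication by `s_e = 1` changes the base vertex without changing the
element. -/
theorem higginsElements_subset (hT : IsMaximalTree T)
    (hL : ∀ {a b : V} (e : a ⟶ b), IsCosetLanguage (𝒢.gens X b) (𝒢.edgeGroup e) (L e))
    (a b : V) : higginsElements T (fun e => L e) b ⊆ higginsElements T (fun e => L e) a := by
  obtain ⟨W⟩ := hT.isTree.connected.preconnected a b
  induction W with
  | nil => exact subset_rfl
  | cons h _ ih =>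
    obtain ⟨e, he⟩ := hT.nonempty_of_adj h
    intro g hg
    have := stable_mul_mem_higginsElements hL e (ih hg)
    rwa [stable_of_mem T he, one_mul] at this

theorem higginsElements_eq_univ (hT : IsMaximalTree T)
    (hL : ∀ {a b : V} (e : a ⟶ b), IsCosetLanguage (𝒢.gens X b) (𝒢.edgeGroup e) (L e))
    (a : V) : higginsElements T (fun e => L e) a = Set.univ := by
  have hsub := higginsElements_subset hT hL
  have h1 : ∀ b h, ∀ g ∈ higginsElements T (fun e => L e) a,
      𝒢.ofVertex T b h * g ∈ higginsElements T (fun e => L e) a := fun b h g hg =>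
    hsub a b (ofVertex_mul_mem_higginsElements h (hsub b a hg))
  have h2 : ∀ {b c : V} (e : b ⟶ c), ∀ g ∈ higginsElements T (fun e => L e) a,
      𝒢.stable T e * g ∈ higginsElements T (fun e => L e) a := fun {b c} e g hg =>
    hsub a b (stable_mul_mem_higginsElements hL e (hsub c a hg))
  -- The stabiliser of the set under left multiplication; the equivalence makes it closed under
  -- inverses.
  let K : Subgroup (𝒢.FundamentalGroup T) :=
    { carrier := {k | ∀ g, k * g ∈ higginsElements T (fun e => L e) a ↔
        g ∈ higginsElements T (fun e => L e) a}
      mul_mem' := fun {k l} hk hl g => by rw [mul_assoc, hk, hl]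
      one_mem' := fun g => by rw [one_mul]
      inv_mem' := fun {k} hk g => by rw [← hk, mul_inv_cancel_left] }
  have hK : K = ⊤ := by
    refine closure_range_ofVertex_stable 𝒢 T K (fun b h g => ⟨fun hg => ?_, h1 b h g⟩)
      fun {b c} e g => ⟨fun hg => ?_, h2 e g⟩
    · simpa using h1 b h⁻¹ _ hg
    · simpa [stable_reverse] using h2 (Quiver.reverse e) _ hg
  refine Set.eq_univ_of_forall fun g => ?_
  have hg : g ∈ K := hK ▸ Subgroup.mem_top g
  have := (hg 1).2 ⟨1, a, .nil a, trivial, trivial, by rw [map_one, one_mul, WordPath.value]⟩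
  rwa [mul_one] at this

theorem isCosetLanguage_higginsCosetLanguage (hT : IsMaximalTree T)
    (hL : ∀ {a b : V} (e : a ⟶ b), IsCosetLanguage (𝒢.gens X b) (𝒢.edgeGroup e) (L e))
    {a₀ b₀ : V} (e₀ : a₀ ⟶ b₀) :
    IsCosetLanguage (𝒢.genMap X T) (𝒢.edgeSubgroup T e₀)
      (𝒢.higginsCosetLanguage X T (fun e => L e) e₀) := by
  intro g
  obtain ⟨g₀, c, p, h1, h2, rfl⟩ :=
    (higginsElements_eq_univ hT hL b₀ ▸ Set.mem_univ g : g ∈ higginsElements T (fun e => L e) b₀)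
  obtain ⟨s, hs, h, hh, e1⟩ := hL e₀ g₀
  refine ⟨_, mem_higginsCosetLanguage_iff.2 ⟨s, hs, c, p, h1, h2, rfl⟩, 𝒢.ofVertex T b₀ h,
    ⟨h, hh, rfl⟩, ?_⟩
  rw [evalWord_append, evalWord_vertexWord, WordPath.evalWord_word, e1, map_mul, mul_assoc]

theorem closure_range_genMap (hX : ∀ a, Subgroup.closure (X a : Set (𝒢.vertexGroup a)) = ⊤) :
    Subgroup.closure (Set.range (𝒢.genMap X T)) = ⊤ := by
  refine closure_range_ofVertex_stable 𝒢 T _ (fun a g => ?_) fun {a b} e => ?_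
  · have hg : g ∈ Subgroup.closure (X a : Set (𝒢.vertexGroup a)) := hX a ▸ Subgroup.mem_top g
    have := Subgroup.mem_map_of_mem (𝒢.ofVertex T a) hg
    rw [MonoidHom.map_closure] at this
    refine Subgroup.closure_mono ?_ this
    rintro _ ⟨y, hy, rfl⟩
    exact ⟨Sum.inl ⟨a, ⟨y, hy⟩⟩, rfl⟩
  · by_cases he : e ∈ T a b
    · rw [stable_of_mem T he]
      exact one_mem _
    · exact Subgroup.subset_closure ⟨Sum.inr ⟨⟨a, b, e⟩, he⟩, rfl⟩

end Representatives

/-! ### The Higgins coset language -/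

section Main

variable {Y : ∀ {a b : V}, (a ⟶ b) → Finset (𝒢.vertexGroup b)}

/-- Here `s_f` cancels the last edge of the path and leaves a vertex group element at its end, which
does not affect lengths. -/
theorem WordPath.length_eq_of_backtrack (hT : IsMaximalTree T) {a b c : V} {f : b ⟶ c}
    {p₁ : WordPath 𝒢 X a c} {q : WordPath 𝒢 X a c} (hp₁ : p₁.IsReduced L) (hq : q.IsReduced L)
    {s : List (X b × Bool)} (hs : evalWord (𝒢.gens X b) s ∈ 𝒢.edgeGroup (Quiver.reverse f))
    {g h : 𝒢.vertexGroup a}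
    (H : 𝒢.ofVertex T a g * value T (p₁.comp (.cons (Quiver.reverse f) s (.nil b))) *
      𝒢.stable T f = 𝒢.ofVertex T a h * value T q) :
    p₁.length = q.length := by
  refine (eq_of_value_eq hT hp₁ hq (g := g) (h := h)
    (x := 𝒢.edgeMap (Quiver.reverse f) (evalWord (𝒢.gens X b) s)) (y := 1) ?_).2.1
  rw [map_one, mul_one, ← H, value_comp, value, value, mul_one, stable_mul_ofVertex T hs,
    stable_reverse]
  simp only [mul_assoc, inv_mul_cancel, mul_one]

/-- Appending the edge `f` with empty label absorbs the generator `s_f` and lengthens the word by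
one letter, which costs 1 in the constant. -/
theorem UniformConstants.interleaved_of_comp_edge (hT : IsMaximalTree T)
    (hY : ∀ {a b : V} (e : a ⟶ b),
      Subgroup.closure (Y e : Set (𝒢.vertexGroup b)) = 𝒢.edgeGroup e) {N M : ℕ}
    (hc : UniformConstants X (fun e => L e) (fun e => Y e) N M)
    {a b c : V} {f : b ⟶ c} (hf : f ∉ T b c) {p : WordPath 𝒢 X a b} {q : WordPath 𝒢 X a c}
    (hp : WordPath.IsReduced L (p.comp (.cons f [] (.nil c)))) (hq : q.IsReduced L)
    {a' : V} {e : a' ⟶ a} {s t : List (X a × Bool)} (hs : s ∈ L e) (ht : t ∈ L e)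
    {h : 𝒢.vertexGroup a} (hh : h ∈ 𝒢.edgeGroup e)
    (H : 𝒢.ofVertex T a (evalWord (𝒢.gens X a) s) * p.value T * 𝒢.stable T f =
      𝒢.ofVertex T a (h * evalWord (𝒢.gens X a) t) * q.value T) :
    Interleaved (𝒢.genMap X T) (1 + (M + 1)) 1 (𝒢.ofVertex T a h)
      (vertexWord X T a s ++ p.word T) (vertexWord X T a t ++ q.word T) := by
  have h1 := (hc.interleaved_path hT hY hp hq hs ht hh (WordLengthLE.one _ 1) (by
    rw [WordPath.value_comp, WordPath.value, WordPath.value, evalWord_nil, map_one,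
      mul_one, mul_one, mul_one, ← mul_assoc]
    exact H)).2
  have h2 : WordPath.word T (.cons f [] (.nil c) : WordPath 𝒢 X b c) =
      [(Sum.inr ⟨⟨b, c, f⟩, hf⟩, true)] := by
    simp [WordPath.word, vertexWord, edgeLetter, hf]
  rw [WordPath.word_comp, h2, ← List.append_assoc] at h1
  exact (Interleaved.concat_left _ _ _ _).trans h1

theorem eq_ofVertex_or_stable (hT : IsMaximalTree T) {x : 𝒢.FundamentalGroup T} (a₀ : V)
    (hx : WordLengthLE (Set.range (𝒢.genMap X T)) 1 x) :
    (∃ a y, WordLengthLE (Set.range (𝒢.gens X a)) 1 y ∧ x = 𝒢.ofVertex T a y) ∨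
      ∃ (b c : V) (f : b ⟶ c), f ∉ T b c ∧ Quiver.reverse f ∉ T c b ∧ x = 𝒢.stable T f := by
  have key : ∀ i, (∃ a y, WordLengthLE (Set.range (𝒢.gens X a)) 1 y ∧
      𝒢.genMap X T i = 𝒢.ofVertex T a y) ∨
      ∃ (b c : V) (f : b ⟶ c), f ∉ T b c ∧ Quiver.reverse f ∉ T c b ∧
        𝒢.genMap X T i = 𝒢.stable T f := by
    rintro (⟨a, y⟩ | ⟨⟨b, c, f⟩, hf⟩)
    · exact Or.inl ⟨a, _, .of_mem ⟨y, rfl⟩, rfl⟩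
    · refine Or.inr ⟨b, c, f, hf, fun h => hf ?_, rfl⟩
      simpa using hT.reverse_mem _ h
  rcases hx.one_cases with rfl | ⟨i, rfl⟩ | ⟨i, hi⟩
  · exact Or.inl ⟨a₀, 1, .one _ 1, (map_one _).symm⟩
  · exact key i
  · rcases key i with ⟨a, y, hy, e⟩ | ⟨b, c, f, h1, h2, e⟩
    · exact Or.inl ⟨a, y⁻¹, hy.inv, by rw [map_inv, ← e, hi, inv_inv]⟩
    · exact Or.inr ⟨c, b, Quiver.reverse f, h2, by simpa using h1, by
        rw [stable_reverse, ← e, hi, inv_inv]⟩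

theorem UniformConstants.interleaved_of_dist (hT : IsMaximalTree T)
    (hY : ∀ {a b : V} (e : a ⟶ b),
      Subgroup.closure (Y e : Set (𝒢.vertexGroup b)) = 𝒢.edgeGroup e)
    (hnil : ∀ {a b : V} (e : a ⟶ b), [] ∈ L e) {N M : ℕ}
    (hc : UniformConstants X (fun e => L e) (fun e => Y e) N M)
    {a₀ b₀ : V} {e₀ : a₀ ⟶ b₀} {p q : List (𝒢.Gen X T × Bool)}
    (hp : p ∈ 𝒢.higginsCosetLanguage X T (fun e => L e) e₀)
    (hq : q ∈ 𝒢.higginsCosetLanguage X T (fun e => L e) e₀)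
    {h : 𝒢.FundamentalGroup T} (hh : h ∈ 𝒢.edgeSubgroup T e₀)
    (hd : CayleyDistLE (𝒢.genMap X T) 1 (evalWord (𝒢.genMap X T) p)
      (h * evalWord (𝒢.genMap X T) q)) :
    Interleaved (𝒢.genMap X T) (1 + (M + 1)) 1 h p q := by
  obtain ⟨s, hs, a, p, hp1, hp2, rfl⟩ := mem_higginsCosetLanguage_iff.1 hp
  obtain ⟨t, ht, d, q, hq1, hq2, rfl⟩ := mem_higginsCosetLanguage_iff.1 hq
  obtain ⟨h, hh, rfl⟩ := hh
  clear hp hq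
  obtain ⟨x, hx⟩ : ∃ x, x = (evalWord (𝒢.genMap X T) (vertexWord X T b₀ s ++ p.word T))⁻¹ *
    (𝒢.ofVertex T b₀ h * evalWord (𝒢.genMap X T) (vertexWord X T b₀ t ++ q.word T)) := ⟨_, rfl⟩
  rw [CayleyDistLE, ← hx] at hd
  rw [eq_inv_mul_iff_mul_eq, evalWord_append, evalWord_append, evalWord_vertexWord,
    evalWord_vertexWord, ← mul_assoc (𝒢.ofVertex T b₀ h), ← map_mul] at hx
  -- The same relation with the two words exchanged, for the case in which the edge is appended to
  -- `q`.
  have hx' : 𝒢.ofVertex T b₀ (evalWord (𝒢.gens X b₀) t) * evalWord (𝒢.genMap X T) (q.word T) *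
      x⁻¹ = 𝒢.ofVertex T b₀ (h⁻¹ * evalWord (𝒢.gens X b₀) s) *
        evalWord (𝒢.genMap X T) (p.word T) := by
    rw [map_mul, map_inv, mul_assoc (_)⁻¹, ← mul_inv_eq_iff_eq_mul.2 hx.symm, map_mul]
    group
  rcases eq_ofVertex_or_stable hT b₀ hd with ⟨c, y, hy, rfl⟩ | ⟨b, c, f, hf, hf', rfl⟩
  · obtain ⟨p', h1, h2⟩ := WordPath.exists_extension hT hnil hp1 hp2 c
    obtain ⟨q', h3, h4⟩ := WordPath.exists_extension hT hnil hq1 hq2 c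
    rw [← h2, ← h4] at hx ⊢
    rw [WordPath.evalWord_word, WordPath.evalWord_word] at hx
    exact (hc.interleaved_path hT hY h1 h3 hs ht hh hy hx).2.mono (Nat.le_add_left _ _)
  · obtain ⟨p', h1, h2⟩ := WordPath.exists_extension hT hnil hp1 hp2 b
    obtain ⟨q', h3, h4⟩ := WordPath.exists_extension hT hnil hq1 hq2 c
    rw [← h2, ← h4] at hx hx' ⊢
    rw [WordPath.evalWord_word, WordPath.evalWord_word] at hx hx'
    rw [← stable_reverse] at hx'
    rcases h1.comp_edge hnil f with h5 | ⟨p₁, u, rfl, h5, h6⟩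
    · exact hc.interleaved_of_comp_edge hT hY hf h5 h3 hs ht hh hx
    rcases h3.comp_edge hnil (Quiver.reverse f) with h7 | ⟨q₁, u', rfl, h7, h8⟩
    · have := (hc.interleaved_of_comp_edge hT hY hf' h7 h1 ht hs (inv_mem hh) hx').symm
      simpa using this.translate (𝒢.ofVertex T b₀ h)
    -- If neither path can be lengthened, both end in a cancelling edge, and each of them would be
    -- one edge longer than the other.
    · have l1 := WordPath.length_eq_of_backtrack hT h6 h3 h5 hx
      have l2 := WordPath.length_eq_of_backtrack hT h8 h1 h7 hx'
      rw [LabelledPath.length_comp] at l1 l2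
      simp only [LabelledPath.length] at l1 l2
      omega

end Main

end GraphOfGroups

open GraphOfGroups in
theorem theorem3p2 {V : Type u} [Quiver.{v} V] [Quiver.HasInvolutiveReverse V]
    -- a finite connected graph
    [Finite V] [∀ a b : V, Finite (a ⟶ b)] (hconn : Quiver.IsStronglyConnected V)
    (𝒢 : GraphOfGroups.{u, v, w} V)
    -- finite generating sets of the vertex groups and of the edge groups
    (X : ∀ a : V, Finset (𝒢.vertexGroup a))
    (hX : ∀ a, Subgroup.closure (X a : Set (𝒢.vertexGroup a)) = ⊤)
    (Y : ∀ {a b : V}, (a ⟶ b) → Finset (𝒢.vertexGroup b))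
    (hY : ∀ {a b : V} (e : a ⟶ b),
      Subgroup.closure (Y e : Set (𝒢.vertexGroup b)) = 𝒢.edgeGroup e)
    -- coset languages that contain the empty word
    (L : ∀ {a b : V}, (a ⟶ b) → Language (X b × Bool))
    (hL : ∀ {a b : V} (e : a ⟶ b),
      IsStronglyAsyncCosetAutomatic (𝒢.gens X b) (𝒢.edgeGroup e) (L e))
    (hnil : ∀ {a b : V} (e : a ⟶ b), [] ∈ L e)
    -- stability of the edge isomorphisms
    (hstable : ∀ {a b : V} (e : a ⟶ b), IsStableIso (𝒢.φ e) (Y e : Set (𝒢.vertexGroup b))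
      (Y (Quiver.reverse e) : Set (𝒢.vertexGroup a)))
    -- limited crossover
    (hcross : ∀ {a a' b : V} (e : a ⟶ b) (f : a' ⟶ b), HasLimitedCrossover (𝒢.gens X b) (L e)
      (Y e : Set (𝒢.vertexGroup b)) (Y f : Set (𝒢.vertexGroup b)))
    -- a maximal tree and an edge
    (T : WideSubquiver V) (hT : IsMaximalTree T) {a₀ b₀ : V} (e₀ : a₀ ⟶ b₀) :
    IsStronglyAsyncCosetAutomatic (𝒢.genMap X T) (𝒢.edgeSubgroup T e₀)
      (𝒢.higginsCosetLanguage X T (fun e => L e) e₀) := by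
  have := finite_total V
  refine ⟨inferInstance, closure_range_genMap hX, ?_,
    isCosetLanguage_higginsCosetLanguage hT (fun e => (hL e).isCosetLanguage) e₀,
    isRegular_higginsCosetLanguage hL hnil e₀, ?_⟩
  · exact (Subgroup.fg_iff_submonoid_fg _).2
      (((Subgroup.fg_iff_submonoid_fg _).1 (hL e₀).subgroup_fg).map (𝒢.ofVertex T b₀))
  · obtain ⟨N, M, hc⟩ := exists_uniformConstants hX hY hL hstable hcross
    exact ⟨_, fun p hp q hq h hh hd =>
      (hc.interleaved_of_dist hT hY hnil hp hq hh hd).asyncFellowTravel⟩
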